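/- **Theorem (Linkedness of the cube).** A polytope is the convex hull of a finite set of points in some $\mathbb{R}^n$; a $d$-polytope is a polytope of dimension $d$. The graph of a polytope consists of its vertices and edges (its faces of dimension $0$ and $1$). A $d$-cube is any polytope whose face lattice is isomorphic to the face lattice of the standard $d$-dimensional cube, the convex hull in $\mathbb{R}^d$ of the $2^d$ vectors $(\pm1,\ldots,\pm1)$. A graph is $k$-linked if it has at least $2k$ vertices and, for every $2k$ distinct vertices $s_1,\ldots,s_k,t_1,\ldots,t_k$, there are $k$ pairwise vertex-disjoint paths $L_1,\ldots,L_k$ such that $L_i$ joins $s_i$ to $t_i$; a polytope is $k$-linked if its graph is. Let $d\ge 0$ be an integer. 1. If $d\ne 3$, then every $d$-cube is $\lfloor (d+1)/2\rfloor$-linked. 2. The value $\lfloor (d+1)/2\rfloor$ is the best possible: for every integer $k>\lfloor (d+1)/2\rfloor$, no $d$-cube is $k$-linked, and in particular there is a $d$-polytope that is not $k$-linked. -/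

import Mathlib

/-- A (convex) polytope: the convex hull of a finite set of points of `ℝⁿ`. Only the affine and
topological structure of `ℝⁿ` is used below, so `ℝⁿ` is taken as `Fin n → ℝ`. -/
def IsPolytope {n : ℕ} (P : Set (Fin n → ℝ)) : Prop :=
  ∃ S : Set (Fin n → ℝ), S.Finite ∧ P = convexHull ℝ S

/-- `A` is nonempty and of (affine) dimension `m`. -/
def HasDim {n : ℕ} (A : Set (Fin n → ℝ)) (m : ℕ) : Prop :=
  A.Nonempty ∧ Module.finrank ℝ (vectorSpan ℝ A) = m

/-- `F` is a face of `P`: a set of the form `{x ∈ P | l x = c}`, where the linear inequality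
`l x ≤ c` is valid on `P`. Both `∅` (take `l = 0`, `c = 1`) and `P` (take `l = 0`, `c = 0`) are
faces. This is Mathlib's `IsExposed`: `F` is empty or the set of maximisers in `P` of some linear
functional. -/
def IsFace {n : ℕ} (P F : Set (Fin n → ℝ)) : Prop :=
  IsExposed ℝ P F

/-- The face lattice of `P`: the set of faces of `P`, ordered by inclusion. -/
abbrev FaceLattice {n : ℕ} (P : Set (Fin n → ℝ)) : Type :=
  {F : Set (Fin n → ℝ) // IsFace P F}

/-- Combinatorial equivalence: isomorphic face lattices. -/
def CombEquiv {m n : ℕ} (P : Set (Fin m → ℝ)) (Q : Set (Fin n → ℝ)) : Prop :=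
  Nonempty (FaceLattice P ≃o FaceLattice Q)

/-- The vertices of `P`: the points `x` for which `{x}` is a (`0`-dimensional) face. -/
abbrev Vertex {n : ℕ} (P : Set (Fin n → ℝ)) : Type :=
  {x : Fin n → ℝ // IsFace P {x}}

/-- The graph `G(P)` of `P`: two distinct vertices are adjacent when they lie on a common edge
(a face of dimension `1`) of `P`. -/
def polytopeGraph {n : ℕ} (P : Set (Fin n → ℝ)) : SimpleGraph (Vertex P) where
  Adj u v := u ≠ v ∧ ∃ e : Set (Fin n → ℝ), IsFace P e ∧ HasDim e 1 ∧ u.1 ∈ e ∧ v.1 ∈ e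
  symm := ⟨fun _ _ ⟨hne, e, he, hd, hu, hv⟩ => ⟨hne.symm, e, he, hd, hv, hu⟩⟩
  loopless := ⟨fun _ h => h.1 rfl⟩

/-- The standard `d`-dimensional cube: the convex hull in `ℝᵈ` of the vectors `(±1, …, ±1)`. -/
def stdCube (d : ℕ) : Set (Fin d → ℝ) :=
  convexHull ℝ {x | ∀ i, x i = 1 ∨ x i = -1}

/-- A `d`-cube: a polytope, in some `ℝⁿ`, combinatorially equivalent to the standard `d`-cube. -/
def IsCube {n : ℕ} (d : ℕ) (P : Set (Fin n → ℝ)) : Prop :=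
  IsPolytope P ∧ CombEquiv P (stdCube d)

/-- `G` is `k`-linked: it has at least `2k` vertices and, for any `2k` distinct vertices
`s₁, …, s_k, t₁, …, t_k`, there are pairwise vertex-disjoint paths joining `s_i` to `t_i`. -/
def IsLinked {V : Type*} (G : SimpleGraph V) (k : ℕ) : Prop :=
  ((2 * k : ℕ) : ℕ∞) ≤ ENat.card V ∧
    ∀ s t : Fin k → V, Function.Injective (Sum.elim s t) →
      ∃ L : ∀ i : Fin k, G.Path (s i) (t i),
        ∀ i j : Fin k, i ≠ j →
          ∀ v : V, v ∈ (L i : G.Walk (s i) (t i)).support →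
            v ∉ (L j : G.Walk (s j) (t j)).support

/-! Everything reduces to the hypercube graph on Boolean vectors. Vertices of a polytope are the
atoms of its face lattice, and an edge is a face lying above exactly two atoms, so every `d`-cube
has the graph of the standard cube.

Linkedness is proved by induction on the dimension in the stronger form `StrongLinkage`: pairs are
linked while avoiding a forbidden set, terminals and forbidden vertices together numbering at most
`d + 1`. View the `(D + 1)`-cube as a prism over the `D`-cube. If a pair agrees in some coordinate,
split along it, join the pair on its own side, and send all other terminals to the opposite side,
either straight along their rungs or after one step to a free neighbour; then induct there. If all
pairs are antipodal, split so that one end `t` of a chosen pair has a free rung; the pair is joined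
on the side of its other end and then crosses to `t`, which the remaining pairs must avoid. Removing
a pair frees two units of the budget; the drop in dimension costs one, and the other pays for `t`.

Two facts carry the step. Hall's theorem supplies distinct free neighbours (`exists_escape`).
Deleting at most `D` vertices from the `D`-cube leaves connected any two vertices that keep a
neighbour (`HasSmallCuts`). The configurations where the counts are tight are excluded because the
cube has no triangles, or are linked by hand.

The induction starts at dimension three with a single pair and gains one pair per dimension. The
resulting `d - 2` pairs suffice for `d ≥ 4` but not for `d = 3`; for `d ≤ 2` there is at most one
pair. Optimality: with more pairs, all neighbours of one terminal can be terminals of other pairs.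
-/

/-! ### Connections inside a set of vertices, and linkages -/

/-- `a` and `b` are joined by a walk of `G` that stays inside `S`. -/
def WalkIn {V : Type*} (G : SimpleGraph V) (S : Set V) (a b : V) : Prop :=
  ∃ p : G.Walk a b, ∀ v ∈ p.support, v ∈ S

namespace WalkIn

variable {V W : Type*} {G : SimpleGraph V} {H : SimpleGraph W} {S T : Set V} {a b c : V}

theorem refl (ha : a ∈ S) : WalkIn G S a a := ⟨.nil, by simpa using ha⟩

theorem of_adj (h : G.Adj a b) (ha : a ∈ S) (hb : b ∈ S) : WalkIn G S a b :=
  ⟨h.toWalk, by simp [ha, hb]⟩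

theorem symm (h : WalkIn G S a b) : WalkIn G S b a := by
  obtain ⟨p, hp⟩ := h
  exact ⟨p.reverse, by simpa using hp⟩

theorem trans (h : WalkIn G S a b) (h' : WalkIn G S b c) : WalkIn G S a c := by
  obtain ⟨p, hp⟩ := h
  obtain ⟨q, hq⟩ := h'
  refine ⟨p.append q, fun v hv => ?_⟩
  rcases (SimpleGraph.Walk.mem_support_append_iff p q).1 hv with hv | hv
  exacts [hp v hv, hq v hv]

theorem mono (h : WalkIn G S a b) (hST : S ⊆ T) : WalkIn G T a b := by
  obtain ⟨p, hp⟩ := h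
  exact ⟨p, fun v hv => hST (hp v hv)⟩

theorem map (h : WalkIn G S a b) (f : G →g H) {T : Set W} (hf : ∀ v ∈ S, f v ∈ T) :
    WalkIn H T (f a) (f b) := by
  obtain ⟨p, hp⟩ := h
  refine ⟨p.map f, fun v hv => ?_⟩
  rw [SimpleGraph.Walk.support_map, List.mem_map] at hv
  obtain ⟨u, hu, rfl⟩ := hv
  exact hf u (hp u hu)

theorem left_mem (h : WalkIn G S a b) : a ∈ S := by
  obtain ⟨p, hp⟩ := h
  exact hp a p.start_mem_support

theorem right_mem (h : WalkIn G S a b) : b ∈ S := h.symm.left_mem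

end WalkIn

/-- The pairs `x (i, false)`, `x (i, true)` can be joined inside pairwise disjoint sets that avoid
`F`. -/
def Linkable {V κ : Type*} (G : SimpleGraph V) (F : Set V) (x : κ × Bool → V) : Prop :=
  ∃ S : κ → Set V, (∀ i j, i ≠ j → Disjoint (S i) (S j)) ∧ (∀ i, Disjoint (S i) F) ∧
    ∀ i, WalkIn G (S i) (x (i, false)) (x (i, true))

namespace Linkable

variable {V W κ : Type*} {G : SimpleGraph V} {H : SimpleGraph W} {F F' : Set V} {x : κ × Bool → V}

theorem mono (h : Linkable G F x) (hF : F' ⊆ F) : Linkable G F' x := by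
  obtain ⟨S, h1, h2, h3⟩ := h
  exact ⟨S, h1, fun i => (h2 i).mono_right hF, h3⟩

theorem of_iso (φ : G ≃g H) (h : Linkable H (φ '' F) (φ ∘ x)) : Linkable G F x := by
  obtain ⟨S, h1, h2, h3⟩ := h
  refine ⟨fun i => φ ⁻¹' S i, fun i j hij => (h1 i j hij).preimage _, fun i => ?_, fun i => ?_⟩
  · refine Set.disjoint_left.2 fun v hv hvF => Set.disjoint_left.1 (h2 i) hv ⟨v, hvF, rfl⟩
  · have := (h3 i).map φ.symm.toHom (T := φ ⁻¹' S i) (fun v hv => by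
      change φ (φ.symm v) ∈ S i
      simpa using hv)
    have e : ∀ v, φ.symm.toHom (φ v) = v := fun v => φ.symm_apply_apply v
    simpa [e] using this

/-- A pair joined inside `S₀` can be split off by forbidding `S₀` to the other pairs. -/
theorem of_ne (i₀ : κ) {S₀ : Set V} (hS₀ : Disjoint S₀ F)
    (hj : WalkIn G S₀ (x (i₀, false)) (x (i₀, true)))
    (h : Linkable G (F ∪ S₀) fun p : {i // i ≠ i₀} × Bool => x (p.1, p.2)) : Linkable G F x := by
  classical
  obtain ⟨S, h1, h2, h3⟩ := h
  refine ⟨fun i => if hi : i = i₀ then S₀ else S ⟨i, hi⟩, fun i j hij => ?_, fun i => ?_,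
    fun i => ?_⟩
  · by_cases hi : i = i₀ <;> by_cases hj : j = i₀ <;> simp only [hi, hj, dite_true, dite_false]
    · exact absurd (hi.trans hj.symm) hij
    · exact ((h2 _).mono_right Set.subset_union_right).symm
    · exact (h2 _).mono_right Set.subset_union_right
    · exact h1 _ _ (by simpa using hij)
  · by_cases hi : i = i₀ <;> simp only [hi, dite_true, dite_false]
    · exact hS₀
    · exact (h2 _).mono_right Set.subset_union_left
  · by_cases hi : i = i₀
    · subst hi; simpa using hj
    · simpa [hi] using h3 ⟨i, hi⟩

/-- `Linkable` only asks for walks in disjoint sets, which concatenate freely; shortening such a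
walk to a path keeps it inside its set. -/
theorem isLinked {k : ℕ} (hcard : ((2 * k : ℕ) : ℕ∞) ≤ ENat.card V)
    (h : ∀ x : Fin k × Bool → V, Function.Injective x → Linkable G ∅ x) : IsLinked G k := by
  classical
  refine ⟨hcard, fun s t hst => ?_⟩
  obtain ⟨S, h1, -, h3⟩ := h (fun p => bif p.2 then t p.1 else s p.1) (by
    rintro ⟨i, b⟩ ⟨j, c⟩ hij
    cases b <;> cases c
    · simpa using hst (a₁ := Sum.inl i) (a₂ := Sum.inl j) hij
    · simpa using hst (a₁ := Sum.inl i) (a₂ := Sum.inr j) hij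
    · simpa using hst (a₁ := Sum.inr i) (a₂ := Sum.inl j) hij
    · simpa using hst (a₁ := Sum.inr i) (a₂ := Sum.inr j) hij)
  choose p hp using h3
  refine ⟨fun i => (p i).toPath, fun i j hij v hvi hvj => ?_⟩
  exact Set.disjoint_left.1 (h1 i j hij) (hp i v ((p i).support_toPath_subset_support hvi))
    (hp j v ((p j).support_toPath_subset_support hvj))

end Linkable

theorem IsLinked.of_iso {V W : Type*} {G : SimpleGraph V} {H : SimpleGraph W} (φ : G ≃g H) {k : ℕ}
    (h : IsLinked G k) : IsLinked H k := by
  classical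
  obtain ⟨hc, hl⟩ := h
  refine ⟨hc.trans_eq (ENat.card_congr φ.toEquiv), fun s t hst => ?_⟩
  obtain ⟨L, hL⟩ := hl (φ.symm ∘ s) (φ.symm ∘ t) (by
    have := φ.symm.injective.comp hst
    rwa [← Sum.comp_elim])
  refine ⟨fun i => (((L i).1.map φ.toHom).copy (φ.apply_symm_apply _)
    (φ.apply_symm_apply _)).toPath, fun i j hij v hvi hvj => ?_⟩
  have key : ∀ i, v ∈ ((((L i).1.map φ.toHom).copy (φ.apply_symm_apply (s i))
      (φ.apply_symm_apply (t i))).toPath : H.Walk (s i) (t i)).support →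
      φ.symm v ∈ (L i).1.support := by
    intro i hv
    have := SimpleGraph.Walk.support_toPath_subset_support _ hv
    rw [SimpleGraph.Walk.support_copy, SimpleGraph.Walk.support_map, List.mem_map] at this
    obtain ⟨u, hu, rfl⟩ := this
    have e : φ.symm (φ.toHom u) = u := φ.symm_apply_apply u
    rwa [e]
  exact hL i j hij _ (key i hvi) (key j hvj)

/-! ### The prism over a graph and the hypercube graph -/

/-- The prism over `G`: two copies of `G`, corresponding vertices being joined. -/
abbrev prism {V : Type*} (G : SimpleGraph V) : SimpleGraph (V × Bool) := G □ (⊤ : SimpleGraph Bool)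

theorem prism_adj_same {V : Type*} {G : SimpleGraph V} {u v : V} {b : Bool} :
    (prism G).Adj (u, b) (v, b) ↔ G.Adj u v := SimpleGraph.boxProd_adj_left

theorem prism_adj_rung {V : Type*} {G : SimpleGraph V} {u : V} :
    (prism G).Adj (u, false) (u, true) := by simp [SimpleGraph.boxProd_adj]

theorem WalkIn.prism {V : Type*} {G : SimpleGraph V} {S : Set V} {u v : V}
    (h : WalkIn G S u v) (b : Bool) {T : Set (V × Bool)} (hT : ∀ v ∈ S, (v, b) ∈ T) :
    WalkIn (prism G) T (u, b) (v, b) :=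
  h.map (G.boxProdLeft ⊤ b).toHom hT

/-- The graph of the `d`-cube. -/
def cube (d : ℕ) : SimpleGraph (Fin d → Bool) where
  Adj v w := ∃ i, v i ≠ w i ∧ ∀ j, j ≠ i → v j = w j
  symm := ⟨fun _ _ ⟨i, h, h'⟩ => ⟨i, h.symm, fun j hj => (h' j hj).symm⟩⟩
  loopless := ⟨fun _ ⟨_, h, _⟩ => h rfl⟩

theorem cube_adj_iff {d : ℕ} {v w : Fin d → Bool} :
    (cube d).Adj v w ↔ ∃ i, w = Function.update v i (!v i) := by
  constructor
  · rintro ⟨i, h, h'⟩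
    refine ⟨i, funext fun j => ?_⟩
    by_cases hj : j = i
    · subst hj; simpa using (Bool.not_eq_iff.2 h).symm
    · simp [hj, h' j hj]
  · rintro ⟨i, rfl⟩
    exact ⟨i, by simp, fun j hj => by simp [hj]⟩

theorem cube_adj_update {d : ℕ} (v : Fin d → Bool) (i : Fin d) :
    (cube d).Adj v (Function.update v i (!v i)) := cube_adj_iff.2 ⟨i, rfl⟩

/-- Flipping two different coordinates of `u` gives vertices that differ in two places. This is what
rules out the tight cases of all later counts. -/
theorem cube_triangle_free {d : ℕ} {u v w : Fin d → Bool} (h1 : (cube d).Adj u v)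
    (h2 : (cube d).Adj u w) : ¬ (cube d).Adj v w := by
  obtain ⟨i, rfl⟩ := cube_adj_iff.1 h1
  obtain ⟨j, rfl⟩ := cube_adj_iff.1 h2
  rintro ⟨l, h, h'⟩
  by_cases hij : i = j
  · subst hij; exact h rfl
  · have h1 : i = l := by
      by_contra hl; simpa [hij] using h' i hl
    have h2 : j = l := by
      by_contra hl; simpa [Ne.symm hij] using h' j hl
    exact hij (h1.trans h2.symm)

/-- The neighbours of a vertex of the cube. -/
def nbrs {d : ℕ} (v : Fin d → Bool) : Finset (Fin d → Bool) :=
  Finset.univ.image fun i => Function.update v i (!v i)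

theorem mem_nbrs {d : ℕ} {v w : Fin d → Bool} : w ∈ nbrs v ↔ (cube d).Adj v w := by
  simp [nbrs, cube_adj_iff, eq_comm]

theorem update_not_injective {d : ℕ} (v : Fin d → Bool) :
    Function.Injective fun i => Function.update v i (!v i) := by
  intro i j hij
  by_contra h
  have := congrFun hij i
  simp [h] at this

theorem card_nbrs {d : ℕ} (v : Fin d → Bool) : (nbrs v).card = d := by
  rw [nbrs, Finset.card_image_of_injective _ (update_not_injective v), Finset.card_univ,
    Fintype.card_fin]

/-- The decomposition of the cube along the direction `e`, with sides labelled so that the vertices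
with `e`-th coordinate `b` are on the side `false`. -/
def cubeSplit {d : ℕ} (e : Fin (d + 1)) (b : Bool) : cube (d + 1) ≃g prism (cube d) where
  toFun f := (e.removeNth f, f e ^^ b)
  invFun p := e.insertNth (p.2 ^^ b) p.1
  left_inv f := by simp
  right_inv p := by simp
  map_rel_iff' {f g} := by
    simp only [Equiv.coe_fn_mk, SimpleGraph.boxProd_adj, SimpleGraph.top_adj, cube, funext_iff,
      Fin.removeNth, Fin.exists_iff_succAbove e, Fin.forall_iff_succAbove e, ne_eq,
      Fin.succAbove_right_inj, Fin.succAbove_ne, Fin.ne_succAbove, not_false_eq_true,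
      not_true_eq_false, forall_const, false_imp_iff, true_and, Bool.xor_left_inj]
    constructor
    · rintro (⟨⟨i, h, h'⟩, h2⟩ | h)
      · exact Or.inr ⟨i, h, h2, h'⟩
      · exact Or.inl h
    · rintro (h | ⟨i, h, h2, h'⟩)
      · exact Or.inr h
      · exact Or.inl ⟨⟨i, h, h'⟩, h2⟩

theorem cubeSplit_apply {d : ℕ} (e : Fin (d + 1)) (b : Bool) (f : Fin (d + 1) → Bool) :
    cubeSplit e b f = (e.removeNth f, f e ^^ b) := rfl

/-! ### Connectivity of the cube -/

/-- The part on the side `b` of a set of vertices of a prism. -/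
def side {V : Type*} [DecidableEq V] (X : Finset (V × Bool)) (b : Bool) : Finset V :=
  (X.filter fun p => p.2 = b).image Prod.fst

theorem mem_side {V : Type*} [DecidableEq V] {X : Finset (V × Bool)} {b : Bool} {v : V} :
    v ∈ side X b ↔ (v, b) ∈ X := by
  simp [side]

theorem card_side_add {V : Type*} [DecidableEq V] (X : Finset (V × Bool)) (b : Bool) :
    (side X b).card + (side X (!b)).card = X.card := by
  have h : ∀ c, (side X c).card = (X.filter fun p => p.2 = c).card := fun c => by
    refine Finset.card_image_of_injOn ?_
    rintro ⟨u, a⟩ hu ⟨v, a'⟩ hv h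
    simp only [Finset.coe_filter, Set.mem_ofPred_eq] at hu hv
    exact Prod.ext h (hu.2.trans hv.2.symm)
  have e : (X.filter fun p => p.2 = !b) = X.filter fun p => ¬ p.2 = b := by
    refine Finset.filter_congr fun p _ => ?_
    cases p.2 <;> cases b <;> simp
  rw [h, h, e, Finset.card_filter_add_card_filter_not]

/-- `D` vertices separate two vertices of `G` only if they contain the neighbourhood of one of
them. -/
def HasSmallCuts {V : Type*} (G : SimpleGraph V) (D : ℕ) : Prop :=
  ∀ (R : Finset V) (s t : V), R.card ≤ D → s ∉ R → t ∉ R → (∃ u ∉ R, G.Adj s u) →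
    (∃ u ∉ R, G.Adj t u) → WalkIn G {v | v ∉ R} s t

theorem HasSmallCuts.of_iso {V W : Type*} {G : SimpleGraph V} {H : SimpleGraph W} {D : ℕ}
    (φ : G ≃g H) (h : HasSmallCuts H D) : HasSmallCuts G D := by
  classical
  rintro R s t hR hs ht ⟨u, hu, hsu⟩ ⟨w, hw, htw⟩
  have key : ∀ v, v ∉ R → φ v ∉ R.map φ.toEquiv.toEmbedding := by
    intro v hv hv'
    obtain ⟨v', h1, h2⟩ := Finset.mem_map.1 hv'
    exact hv ((φ.injective h2) ▸ h1)
  have := (h (R.map φ.toEquiv.toEmbedding) (φ s) (φ t) (by simpa using hR) (key s hs) (key t ht)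
    ⟨φ u, key u hu, φ.map_adj_iff.2 hsu⟩ ⟨φ w, key w hw, φ.map_adj_iff.2 htw⟩).map φ.symm.toHom
    (T := {v | v ∉ R}) (fun v hv hv' => hv (Finset.mem_map.2 ⟨_, hv', φ.apply_symm_apply v⟩))
  have e : ∀ v, φ.symm.toHom (φ v) = v := fun v => φ.symm_apply_apply v
  simpa [e] using this

theorem exists_adj_not_mem {D : ℕ} {R : Finset (Fin D → Bool)} {s : Fin D → Bool}
    (h : ¬ nbrs s ⊆ R) : ∃ u ∉ R, (cube D).Adj s u := by
  obtain ⟨u, hu, huR⟩ := Finset.not_subset.1 h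
  exact ⟨u, huR, mem_nbrs.1 hu⟩

theorem nbrs_not_subset_of_card_lt {D : ℕ} {R : Finset (Fin D → Bool)} (hR : R.card < D)
    (s : Fin D → Bool) : ¬ nbrs s ⊆ R := fun h => by
  have := Finset.card_le_card h
  rw [card_nbrs] at this
  omega

theorem HasSmallCuts.walkIn_of_card_lt {D : ℕ} (h : HasSmallCuts (cube D) D)
    {R : Finset (Fin D → Bool)} {s t : Fin D → Bool} (hR : R.card < D) (hs : s ∉ R) (ht : t ∉ R) :
    WalkIn (cube D) {v | v ∉ R} s t :=
  h R s t hR.le hs ht (exists_adj_not_mem (nbrs_not_subset_of_card_lt hR s))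
    (exists_adj_not_mem (nbrs_not_subset_of_card_lt hR t))

/-- For `D ≤ 1` one removed vertex is not fewer than `D`, but there any two vertices are equal or
adjacent. -/
theorem HasSmallCuts.walkIn_of_card_le_one {D : ℕ} (h : HasSmallCuts (cube D) D)
    {R : Finset (Fin D → Bool)} {s t : Fin D → Bool} (hR : R.card ≤ 1) (hs : s ∉ R) (ht : t ∉ R) :
    WalkIn (cube D) {v | v ∉ R} s t := by
  match D, h with
  | 0, _ => exact Subsingleton.elim s t ▸ .refl hs
  | 1, _ =>
    by_cases hst : s = t
    · exact hst ▸ .refl hs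
    · refine .of_adj ⟨0, fun h0 => hst (funext fun i => ?_), fun j hj => ?_⟩ hs ht
      · rwa [Subsingleton.elim i 0]
      · exact absurd (Subsingleton.elim j 0) hj
  | D + 2, h => exact h.walkIn_of_card_lt (by omega) hs ht

/-- If one side contains at least `D` vertices of `R`, the other contains at most one and stays
connected. A vertex of the crowded side reaches it along its own rung or, if that is blocked, along
the rung of a free neighbour. Otherwise both sides stay connected and a free rung joins them. -/
theorem hasSmallCuts_prism {D : ℕ} (h : HasSmallCuts (cube D) D) :
    HasSmallCuts (prism (cube D)) (D + 1) := by
  rintro R ⟨s, a⟩ ⟨t, c⟩ hR hs ht hs' ht'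
  have hcard := card_side_add R
  have rung : ∀ (v : Fin D → Bool) (b : Bool), (v, b) ∉ R → (v, !b) ∉ R →
      WalkIn (prism (cube D)) {v | v ∉ R} (v, b) (v, !b) := by
    intro v b h1 h2
    cases b
    · exact .of_adj prism_adj_rung h1 h2
    · exact .of_adj prism_adj_rung.symm h1 h2
  by_cases hb : ∃ b, D ≤ (side R b).card
  · obtain ⟨b, hb⟩ := hb
    have hb1 : (side R (!b)).card ≤ 1 := by have := hcard b; omega
    have conn : ∀ u v, (u, !b) ∉ R → (v, !b) ∉ R →
        WalkIn (prism (cube D)) {v | v ∉ R} (u, !b) (v, !b) := fun u v hu hv =>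
      (h.walkIn_of_card_le_one (R := side R (!b)) hb1 (by rwa [mem_side])
        (by rwa [mem_side])).prism _ (fun w hw => by simpa [mem_side] using hw)
    have reach : ∀ v a, (v, a) ∉ R → (∃ u ∉ R, (prism (cube D)).Adj (v, a) u) →
        ∃ w, (w, !b) ∉ R ∧ WalkIn (prism (cube D)) {v | v ∉ R} (v, a) (w, !b) := by
      rintro v a hv ⟨⟨u, c⟩, hu, hadj⟩
      by_cases hab : a = !b
      · subst hab; exact ⟨v, hv, .refl hv⟩
      · obtain rfl : a = b := by cases a <;> cases b <;> simp_all
        by_cases hv' : (v, !a) ∈ R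
        · have hca : c = a := by
            by_contra hca
            obtain rfl : c = !a := by cases a <;> cases c <;> simp_all
            have : v = u := by simpa [SimpleGraph.boxProd_adj] using hadj
            exact hu (this ▸ hv')
          subst hca
          have huv := prism_adj_same.1 hadj
          have hu' : (u, !c) ∉ R := fun hu' =>
            huv.ne (Finset.card_le_one.1 hb1 v (mem_side.2 hv') u (mem_side.2 hu'))
          exact ⟨u, hu', (WalkIn.of_adj hadj hv hu).trans (rung u c hu hu')⟩
        · exact ⟨v, hv', rung v a hv hv'⟩
    obtain ⟨u, hu, hsu⟩ := reach s a hs hs'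
    obtain ⟨w, hw, htw⟩ := reach t c ht ht'
    exact hsu.trans ((conn u w hu hw).trans htw.symm)
  · push Not at hb
    have conn : ∀ b u v, (u, b) ∉ R → (v, b) ∉ R →
        WalkIn (prism (cube D)) {v | v ∉ R} (u, b) (v, b) := fun b u v hu hv =>
      (h.walkIn_of_card_lt (R := side R b) (hb b) (by rwa [mem_side])
        (by rwa [mem_side])).prism _ (fun w hw => by simpa [mem_side] using hw)
    -- A rung with both ends free exists since `D + 1 < 2 ^ D` for `D ≥ 2`. For `D = 1` the bounds
    -- `hb` make `R` empty, and for `D = 0` they are contradictory.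
    obtain ⟨w, hw⟩ : ∃ w, w ∉ side R false ∪ side R true := by
      by_contra! hall
      have h1 := Finset.card_le_card (fun w _ => hall w :
        (Finset.univ : Finset (Fin D → Bool)) ⊆ side R false ∪ side R true)
      have h2 := Finset.card_union_le (side R false) (side R true)
      have h3 := hcard false
      have h4 := hb false
      have h5 := hb true
      have h6 := Nat.lt_two_pow_self (n := D)
      simp only [Finset.card_univ, Fintype.card_pi, Fintype.card_bool, Finset.prod_const,
        Fintype.card_fin, Bool.not_false] at h1 h3
      have h7 : D = 1 ∨ D + 1 < 2 ^ D ∨ D = 0 := by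
        rcases D with _ | _ | D
        · simp
        · simp
        · right; left
          have := Nat.lt_two_pow_self (n := D + 1)
          rw [pow_succ]; omega
      rcases h7 with rfl | h7 | rfl <;> omega
    rw [Finset.mem_union, mem_side, mem_side, not_or] at hw
    have hw' : ∀ b, (w, b) ∉ R := by
      intro b; cases b
      exacts [hw.1, hw.2]
    have h1 := conn a s w hs (hw' a)
    have h2 := conn c w t (hw' c) ht
    by_cases hac : c = a
    · subst hac; exact h1.trans h2
    · obtain rfl : c = !a := by cases a <;> cases c <;> simp_all
      exact h1.trans ((rung w a (hw' _) (hw' _)).trans h2)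

theorem hasSmallCuts_cube : ∀ D, HasSmallCuts (cube D) D
  | 0 => fun _ s t _ hs _ _ _ => Subsingleton.elim s t ▸ .refl hs
  | D + 1 => (hasSmallCuts_prism (hasSmallCuts_cube D)).of_iso (cubeSplit 0 false)

theorem cube_walkIn {D : ℕ} {R : Finset (Fin D → Bool)} {s t : Fin D → Bool} (hR : R.card ≤ D)
    (hs : s ∉ R) (ht : t ∉ R) (hs' : ¬ nbrs s ⊆ R) (ht' : ¬ nbrs t ⊆ R) :
    WalkIn (cube D) {v | v ∉ R} s t :=
  hasSmallCuts_cube D R s t hR hs ht (exists_adj_not_mem hs') (exists_adj_not_mem ht')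

theorem cube_walkIn_of_card_lt {D : ℕ} {R : Finset (Fin D → Bool)} {s t : Fin D → Bool}
    (hR : R.card < D) (hs : s ∉ R) (ht : t ∉ R) : WalkIn (cube D) {v | v ∉ R} s t :=
  (hasSmallCuts_cube D).walkIn_of_card_lt hR hs ht

/-! ### Escaping from doubly occupied columns -/

/-- A Hall type lemma: the vertices of `B` have distinct neighbours outside `U ⊇ B`, unless `B`
is a single vertex whose neighbourhood is the rest of `U`. -/
theorem exists_escape {D : ℕ} {B U : Finset (Fin D → Bool)} {s : Fin D → Bool} (hBU : B ⊆ U)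
    (hs : s ∈ U) (hsB : s ∉ B) (hU : U.card + B.card ≤ D + 2) :
    (∃ y : (Fin D → Bool) → Fin D → Bool, Set.InjOn y B ∧
      ∀ w ∈ B, (cube D).Adj w (y w) ∧ y w ∉ U) ∨
    ∃ w, B = {w} ∧ nbrs w = U.erase w ∧ U.card = D + 1 := by
  by_cases hE : ∃ w, B = {w} ∧ nbrs w ⊆ U.erase w
  · obtain ⟨w, hB, hw⟩ := hE
    have hwU : w ∈ U := hBU (by simp [hB])
    have h1 : (U.erase w).card ≤ D := by
      rw [Finset.card_erase_of_mem hwU]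
      rw [hB, Finset.card_singleton] at hU
      omega
    have h2 := Finset.eq_of_subset_of_card_le hw (by rwa [card_nbrs])
    refine Or.inr ⟨w, hB, h2, ?_⟩
    have h3 := congrArg Finset.card h2
    rw [card_nbrs, Finset.card_erase_of_mem hwU] at h3
    have := Finset.card_pos.2 ⟨w, hwU⟩
    omega
  left
  push Not at hE
  have inter : ∀ w ∈ B, (nbrs w ∩ U).card + 1 ≤ U.card := by
    intro w hw
    have h1 : nbrs w ∩ U ⊆ U.erase w := fun v hv => by
      rw [Finset.mem_inter, mem_nbrs] at hv
      exact Finset.mem_erase.2 ⟨hv.1.ne', hv.2⟩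
    have := Finset.card_le_card h1
    rw [Finset.card_erase_of_mem (hBU hw)] at this
    have := Finset.card_pos.2 ⟨w, hBU hw⟩
    omega
  have split : ∀ w, (nbrs w \ U).card + (nbrs w ∩ U).card = D := fun w => by
    rw [Finset.card_sdiff_add_card_inter, card_nbrs]
  -- Each `w ∈ B` has at least `D + 1 - |U| ≥ |B| - 1` neighbours outside `U`, so Hall's condition
  -- can fail only for `S = B`.
  have hall : ∀ S : Finset B, S.card ≤ (S.biUnion fun w => nbrs w.1 \ U).card := by
    intro S
    rcases S.eq_empty_or_nonempty with rfl | ⟨w₀, hw₀⟩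
    · simp
    have hle : ∀ w ∈ S, (nbrs w.1 \ U).card ≤ (S.biUnion fun w => nbrs w.1 \ U).card :=
      fun w hw => Finset.card_le_card (Finset.subset_biUnion_of_mem (fun w : B => nbrs w.1 \ U) hw)
    have hScard : S.card ≤ B.card := by simpa using Finset.card_le_univ S
    by_cases hlt : S.card < B.card
    · have h1 := inter w₀.1 w₀.2
      have h2 := split w₀.1
      have h3 := hle w₀ hw₀
      omega
    have hSu : S = Finset.univ := by
      refine Finset.eq_univ_of_card S ?_
      rw [Fintype.card_coe]; omega
    -- Failure at `S = B` forces equality: each `w ∈ B` is adjacent to all the rest of `U`. If `|B|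
    -- = 1`, this is the exception already set aside; otherwise two vertices of `B` and `s` form a
    -- triangle.
    by_contra hcon
    have hfull : ∀ w (hw : w ∈ B), U.erase w ⊆ nbrs w := by
      intro w hw v hv
      by_contra hvw
      have h0 : nbrs w ∩ U ⊆ (U.erase w).erase v := fun u hu => by
        rw [Finset.mem_inter] at hu
        refine Finset.mem_erase.2 ⟨fun h => hvw (h ▸ hu.1), Finset.mem_erase.2 ⟨?_, hu.2⟩⟩
        exact (mem_nbrs.1 hu.1).ne'
      have h1 := Finset.card_le_card h0
      rw [Finset.card_erase_of_mem hv, Finset.card_erase_of_mem (hBU hw)] at h1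
      have h2 := Finset.card_pos.2 ⟨v, hv⟩
      rw [Finset.card_erase_of_mem (hBU hw)] at h2
      have h3 := split w
      have h4 := hle ⟨w, hw⟩ (by simp [hSu])
      simp only at h4
      omega
    by_cases hB1 : B.card = 1
    · obtain ⟨w, hw⟩ := Finset.card_eq_one.1 hB1
      have hwB : w ∈ B := by simp [hw]
      have h1 := hE w hw
      obtain ⟨v, hv, hvU⟩ := Finset.not_subset.1 h1
      have hvU' : v ∉ U := fun h => hvU (Finset.mem_erase.2 ⟨(mem_nbrs.1 hv).ne', h⟩)
      have h2 := hle ⟨w, hwB⟩ (by simp [hSu])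
      have h3 : 0 < (nbrs w \ U).card := Finset.card_pos.2 ⟨v, Finset.mem_sdiff.2 ⟨hv, hvU'⟩⟩
      simp only at h2
      omega
    · obtain ⟨w, hw, w', hw', hne⟩ := Finset.one_lt_card.1 (show 1 < B.card by
        have := Finset.card_pos.2 ⟨w₀.1, w₀.2⟩
        omega)
      have a1 := mem_nbrs.1 (hfull w hw (Finset.mem_erase.2 ⟨hne.symm, hBU hw'⟩))
      have a2 := mem_nbrs.1 (hfull w hw
        (Finset.mem_erase.2 ⟨fun h : s = w => hsB (h ▸ hw), hs⟩))
      have a3 := mem_nbrs.1 (hfull w' hw'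
        (Finset.mem_erase.2 ⟨fun h : s = w' => hsB (h ▸ hw'), hs⟩))
      exact cube_triangle_free a1 a2 a3
  obtain ⟨f, hf, hf'⟩ := (Finset.all_card_le_biUnion_card_iff_exists_injective _).1 hall
  refine ⟨fun w => if hw : w ∈ B then f ⟨w, hw⟩ else w, ?_, ?_⟩
  · intro w hw w' hw' h
    simp only [Finset.mem_coe] at hw hw'
    simp only [hw, hw', dite_true] at h
    exact congrArg Subtype.val (hf h)
  · intro w hw
    have := hf' ⟨w, hw⟩
    rw [Finset.mem_sdiff, mem_nbrs] at this
    simpa [hw] using this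

/-- Vertices `XA` on one side of the prism and `XB` on the other can be moved to the second side
so that `s` and `t` remain connected on the first side, with two exceptions. -/
theorem escape_trichotomy {D : ℕ} {XA XB : Finset (Fin D → Bool)} {s t : Fin D → Bool}
    (hst : s ≠ t) (hs : s ∉ XA) (ht : t ∉ XA) (hcard : XA.card + XB.card ≤ D) :
    (∃ n : (Fin D → Bool) → Fin D → Bool, Set.InjOn n XA ∧ (∀ w ∈ XA, w ∉ XB → n w = w) ∧
      (∀ w ∈ XA, w ∈ XB → (cube D).Adj w (n w) ∧ n w ∉ XA ∪ XB ∪ {s, t}) ∧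
      WalkIn (cube D) {v | v ∉ XA ∧ v ∉ n '' XA} s t) ∨
    (∃ w, XA ∩ XB = {w} ∧ nbrs w = (XA ∪ XB ∪ {s, t}).erase w ∧
      ∀ u ∈ XA ∪ XB, WalkIn (cube D) {v | v ∉ insert u XA} s t) ∨
    XB = ∅ ∧ (nbrs s = XA ∨ nbrs t = XA) := by
  have hp : ({s, t} : Finset (Fin D → Bool)).card = 2 := Finset.card_pair hst
  have hui := Finset.card_union_add_card_inter XA XB
  have hule := Finset.card_union_le (XA ∪ XB) {s, t}
  rcases exists_escape (B := XA ∩ XB) (U := XA ∪ XB ∪ {s, t}) (s := s)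
    (fun v hv => by simp [(Finset.mem_inter.1 hv).1]) (by simp) (by simp [hs]) (by omega) with
    ⟨y, hy, hy'⟩ | ⟨w, hw, hn, hc⟩
  -- Each escape vertex is paid for by the element of `XB` in the column it leaves, so `R` has at
  -- most `D` elements.
  · set R := XA ∪ (XA ∩ XB).image y with hR
    have hib : (XA ∩ XB).card ≤ XB.card := Finset.card_le_card Finset.inter_subset_right
    have hRc : R.card ≤ D := by
      have h1 := Finset.card_union_le XA ((XA ∩ XB).image y)
      have h2 := Finset.card_image_le (s := XA ∩ XB) (f := y)
      rw [← hR] at h1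
      omega
    have hnR : ∀ z ∈ ({s, t} : Finset (Fin D → Bool)), z ∉ R := by
      intro z hz hzR
      rcases Finset.mem_union.1 hzR with h | h
      · simp only [Finset.mem_insert, Finset.mem_singleton] at hz
        rcases hz with rfl | rfl
        exacts [hs h, ht h]
      · obtain ⟨w, hw, rfl⟩ := Finset.mem_image.1 h
        exact (hy' w hw).2 (Finset.mem_union_right _ hz)
    -- By cardinality `nbrs z = R`. A doubly occupied `w` and its escape `y w` would form a triangle
    -- with `z`, so there is none; then `XA` already uses up all `D` units.
    have exc : ∀ z, nbrs z ⊆ R → XB = ∅ ∧ nbrs z = XA := by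
      intro z hz
      have h1 := Finset.eq_of_subset_of_card_le hz (by rwa [card_nbrs])
      have h2 : XA ∩ XB = ∅ := by
        by_contra hne
        obtain ⟨w, hw⟩ := Finset.nonempty_iff_ne_empty.2 hne
        have a1 := mem_nbrs.1 (h1.symm ▸ Finset.mem_union_left _ (Finset.mem_inter.1 hw).1 :
          w ∈ nbrs z)
        have a2 := mem_nbrs.1 (h1.symm ▸ Finset.mem_union_right _
          (Finset.mem_image_of_mem y hw) : y w ∈ nbrs z)
        exact cube_triangle_free a1 a2 (hy' w hw).1
      have h3 : nbrs z = XA := by rw [h1, hR, h2]; simp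
      refine ⟨?_, h3⟩
      have h4 := card_nbrs z
      rw [h3] at h4
      exact Finset.card_eq_zero.1 (by omega)
    by_cases hs' : nbrs s ⊆ R
    · exact Or.inr (Or.inr ⟨(exc s hs').1, Or.inl (exc s hs').2⟩)
    by_cases ht' : nbrs t ⊆ R
    · exact Or.inr (Or.inr ⟨(exc t ht').1, Or.inr (exc t ht').2⟩)
    left
    refine ⟨fun w => if w ∈ XB then y w else w, ?_, fun w _ hw => by simp [hw],
      fun w hwA hwB => by simpa [hwB] using hy' w (Finset.mem_inter.2 ⟨hwA, hwB⟩), ?_⟩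
    · intro w hw w' hw' h
      simp only [Finset.mem_coe] at hw hw'
      by_cases h1 : w ∈ XB <;> by_cases h2 : w' ∈ XB <;> simp only [h1, h2, if_true, if_false] at h
      · exact hy (Finset.mem_coe.2 (Finset.mem_inter.2 ⟨hw, h1⟩))
          (Finset.mem_coe.2 (Finset.mem_inter.2 ⟨hw', h2⟩)) h
      · exact absurd (by simp [h, hw']) (hy' w (Finset.mem_inter.2 ⟨hw, h1⟩)).2
      · exact absurd (by simp [← h, hw]) (hy' w' (Finset.mem_inter.2 ⟨hw', h2⟩)).2
      · exact h
    · refine (cube_walkIn hRc (hnR s (by simp)) (hnR t (by simp)) hs' ht').mono fun v hv => ?_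
      simp only [Set.mem_ofPred_eq, hR, Finset.mem_union, not_or] at hv
      refine ⟨hv.1, ?_⟩
      rintro ⟨w, hw, rfl⟩
      by_cases h1 : w ∈ XB
      · simp only [h1, if_true] at hv
        exact hv.2 (Finset.mem_image_of_mem y (Finset.mem_inter.2 ⟨hw, h1⟩))
      · simp only [h1, if_false] at hv
        exact hv.1 hw
  · right; left
    rw [hw, Finset.card_singleton] at hui
    have hui2 := Finset.card_union_add_card_inter (XA ∪ XB) {s, t}
    -- One column is counted twice, so `XA ∪ XB` has at most `D - 1` elements; the total `D + 1`
    -- forces `s` and `t` outside it. Deleting `D - 1` vertices does not disconnect the cube.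
    have hemp : (XA ∪ XB) ∩ {s, t} = ∅ := Finset.card_eq_zero.1 (by omega)
    have hsB : s ∉ XA ∪ XB := fun h => by
      have : s ∈ (XA ∪ XB) ∩ {s, t} := Finset.mem_inter.2 ⟨h, by simp⟩
      simp [hemp] at this
    have htB : t ∉ XA ∪ XB := fun h => by
      have : t ∈ (XA ∪ XB) ∩ {s, t} := Finset.mem_inter.2 ⟨h, by simp⟩
      simp [hemp] at this
    refine ⟨w, hw, hn, fun u hu => ?_⟩
    have hsub : insert u XA ⊆ XA ∪ XB := Finset.insert_subset hu Finset.subset_union_left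
    refine cube_walkIn_of_card_lt ?_ (fun h => hsB (hsub h)) (fun h => htB (hsub h))
    have := Finset.card_le_card hsub
    omega

/-! ### Linkages in the cube -/

/-- Every family of at most `j` pairs in the `d`-cube can be linked while avoiding a forbidden set,
provided that there are at most `d + 1` terminals and forbidden vertices. -/
def StrongLinkage (d j : ℕ) : Prop :=
  ∀ (κ : Type) [Fintype κ] (x : κ × Bool → Fin d → Bool) (F : Finset (Fin d → Bool)),
    Function.Injective x → (∀ p, x p ∉ F) → Fintype.card κ ≤ j →
      2 * Fintype.card κ + F.card ≤ d + 1 → Linkable (cube d) F x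

theorem strongLinkage_one (d : ℕ) : StrongLinkage d 1 := by
  intro κ _ x F hx hF hκ hc
  have hsub : Subsingleton κ := Fintype.card_le_one_iff_subsingleton.1 hκ
  refine ⟨fun _ => {v | v ∉ F}, fun i j hij => absurd (Subsingleton.elim i j) hij,
    fun i => Set.disjoint_left.2 fun v hv hv' => hv hv', fun i => ?_⟩
  have := Fintype.card_pos_iff.2 ⟨i⟩
  exact cube_walkIn_of_card_lt (by omega) (hF _) (hF _)

/-- Terminals on the side `false` of a prism are moved to the side `true`, directly or after one
step on their own side; the linkage is then found on the side `true`. -/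
theorem linkable_prism_of_moves {V κ : Type*} {G : SimpleGraph V} {x : κ × Bool → V × Bool}
    {F : Set (V × Bool)} {n : κ × Bool → V} (hx : Function.Injective x) (hF : ∀ p, x p ∉ F)
    (hn : Function.Injective n) (h1 : ∀ p, (x p).2 = true → n p = (x p).1)
    (h2 : ∀ p, (x p).2 = false → n p = (x p).1 ∨
      G.Adj (x p).1 (n p) ∧ (n p, false) ∉ F ∧ ∀ q, x q ≠ (n p, false))
    (hL : Linkable G {v | (v, true) ∈ F} n) : Linkable (prism G) F x := by
  obtain ⟨S, hS1, hS2, hS3⟩ := hL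
  -- On the side `true` the pair keeps its set `S i`; on the side `false` it owns only its terminals
  -- and the vertices from which they cross.
  let T : κ → Set (V × Bool) := fun i => {z | (z.2 = true ∧ z.1 ∈ S i) ∨
    (z.2 = false ∧ ∃ b, (x (i, b)).2 = false ∧ (z.1 = (x (i, b)).1 ∨ z.1 = n (i, b)))}
  have cross : ∀ p q, (x p).2 = false → (x q).2 = false → (x p).1 = n q → p = q := by
    intro p q hp hq h
    rcases h2 q hq with h' | ⟨-, -, h'⟩
    · exact hx (Prod.ext (h.trans h') (hp.trans hq.symm))
    · exact absurd (Prod.ext h hp) (h' p)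
  have reach : ∀ i b, n (i, b) ∈ S i → WalkIn (prism G) (T i) (x (i, b)) (n (i, b), true) := by
    intro i b hb
    have e2 : ((n (i, b), true) : V × Bool) ∈ T i := Or.inl ⟨rfl, hb⟩
    obtain ⟨⟨v, c⟩, hv⟩ : ∃ z, x (i, b) = z := ⟨_, rfl⟩
    cases c with
    | true =>
      have := h1 (i, b) (by rw [hv])
      rw [hv] at this ⊢
      rw [this] at e2 ⊢
      exact .refl e2
    | false =>
      have hv2 : (x (i, b)).2 = false := by rw [hv]
      have e1 : ((n (i, b), false) : V × Bool) ∈ T i := Or.inr ⟨rfl, b, hv2, Or.inr rfl⟩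
      have e0 : ((v, false) : V × Bool) ∈ T i := Or.inr ⟨rfl, b, hv2, Or.inl (by rw [hv])⟩
      have hr : WalkIn (prism G) (T i) (n (i, b), false) (n (i, b), true) :=
        .of_adj prism_adj_rung e1 e2
      rw [hv]
      rcases h2 (i, b) hv2 with h | ⟨h, -⟩
      · rw [hv] at h
        simp only at h
        rwa [← h]
      · rw [hv] at h
        exact (WalkIn.of_adj (prism_adj_same.2 h) e0 e1).trans hr
  refine ⟨T, fun i j hij => Set.disjoint_left.2 ?_, fun i => Set.disjoint_left.2 ?_, fun i => ?_⟩
  · rintro ⟨v, c⟩ (⟨hc, hv⟩ | ⟨hc, b, hb, hv⟩) (⟨hc', hv'⟩ | ⟨hc', b', hb', hv'⟩)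
    · exact Set.disjoint_left.1 (hS1 i j hij) hv hv'
    · simp_all
    · simp_all
    · have : ((i, b) : κ × Bool) = (j, b') := by
        rcases hv with hv | hv <;> rcases hv' with hv' | hv'
        · exact hx (Prod.ext (hv.symm.trans hv') (hb.trans hb'.symm))
        · exact cross _ _ hb hb' (hv.symm.trans hv')
        · exact (cross _ _ hb' hb (hv'.symm.trans hv)).symm
        · exact hn (hv.symm.trans hv')
      exact hij (congrArg Prod.fst this)
  · rintro ⟨v, c⟩ (⟨hc, hv⟩ | ⟨hc, b, hb, hv⟩) hvF
    · simp only at hc hv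
      exact Set.disjoint_left.1 (hS2 i) hv (show (v, true) ∈ F from hc ▸ hvF)
    · simp only at hc hv
      subst hc
      have e : ∀ w, w = (x (i, b)).1 → ((w, false) : V × Bool) ∉ F := fun w hw hwF =>
        hF (i, b) ((Prod.ext hw.symm hb : x (i, b) = (w, false)) ▸ hwF)
      rcases hv with hv | hv
      · exact e v hv hvF
      · rcases h2 (i, b) hb with h | ⟨-, h, -⟩
        · exact e v (hv.trans h) hvF
        · exact h (hv ▸ hvF)
  · have hj := hS3 i
    exact (reach i false hj.left_mem).trans ((hj.prism true fun v hv => Or.inl ⟨rfl, hv⟩).trans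
      (reach i true hj.right_mem).symm)

/-- The case of `linkable_prism_of_moves` in which all moves are along the rungs. -/
theorem linkable_prism_of_rungs {D j : ℕ} (H : StrongLinkage D j) {κ : Type} [Fintype κ]
    {x : κ × Bool → (Fin D → Bool) × Bool} {F : Set ((Fin D → Bool) × Bool)}
    (hx : Function.Injective x) (hF : ∀ p, x p ∉ F)
    (hr : ∀ p, (x p).2 = false → ((x p).1, true) ∉ F ∧ ∀ q, x q ≠ ((x p).1, true))
    {C : Finset (Fin D → Bool)} (hC : ∀ v, (v, true) ∈ F → v ∈ C) (hκ : Fintype.card κ ≤ j)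
    (hcard : 2 * Fintype.card κ + C.card ≤ D + 1) : Linkable (prism (cube D)) F x := by
  classical
  have hinj : Function.Injective fun p => (x p).1 := by
    intro p q h
    simp only at h
    have key : ∀ p q, (x p).1 = (x q).1 → (x p).2 = false → (x q).2 = false := by
      intro p q h hp
      by_contra hq
      exact (hr p hp).2 q (Prod.ext h.symm (by simpa using hq))
    refine hx (Prod.ext h ?_)
    have h1 := key p q h
    have h2 := key q p h.symm
    cases h3 : (x p).2 <;> cases h4 : (x q).2 <;> simp_all
  refine linkable_prism_of_moves hx hF hinj (fun _ _ => rfl) (fun _ _ => Or.inl rfl) ?_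
  have hle : (C.filter fun v => (v, true) ∈ F).card ≤ C.card := Finset.card_filter_le _ _
  refine (H κ (fun p => (x p).1) (C.filter fun v => (v, true) ∈ F) hinj (fun p hp => ?_) hκ
    (by omega)).mono fun v hv => ?_
  · have h1 := (Finset.mem_filter.1 hp).2
    by_cases h : (x p).2 = false
    · exact (hr p h).1 h1
    · have : x p = ((x p).1, true) := Prod.ext rfl (by simpa using h)
      exact hF p (this ▸ h1)
  · exact Finset.mem_coe.2 (Finset.mem_filter.2 ⟨hC v hv, hv⟩)

/-! ### Joining two vertices on one side and linking the remaining pairs -/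

/-- `link_prism_rest` in the case that an escape map `n` exists. -/
theorem link_prism_rest_of_escape {D j : ℕ} (H : StrongLinkage D j) {κ : Type} [Fintype κ]
    {x : κ × Bool → (Fin D → Bool) × Bool} {F : Finset ((Fin D → Bool) × Bool)}
    {s t : Fin D → Bool} {E : Finset (Fin D → Bool)}
    (hx : Function.Injective x) (hF : ∀ p, x p ∉ F)
    (ht : (t, false) ∉ F ∪ Finset.univ.image x)
    (hE : E ⊆ {t}) (hEx : ∀ v ∈ E, ∀ p, x p ≠ (v, true)) (hκ : Fintype.card κ ≤ j)
    (hcard : 2 * Fintype.card κ + F.card ≤ D)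
    {XA XB : Finset (Fin D → Bool)} (hXA : side (F ∪ Finset.univ.image x) false = XA)
    (hXB : side (F ∪ Finset.univ.image x) true = XB) {n : (Fin D → Bool) → Fin D → Bool}
    (hn : Set.InjOn n XA) (hn1 : ∀ w ∈ XA, w ∉ XB → n w = w)
    (hn2 : ∀ w ∈ XA, w ∈ XB → (cube D).Adj w (n w) ∧ n w ∉ XA ∪ XB ∪ {s, t})
    (hw : WalkIn (cube D) {v | v ∉ XA ∧ v ∉ n '' XA} s t) :
    ∃ S : Set (Fin D → Bool), WalkIn (cube D) S s t ∧ (∀ v ∈ S, (v, false) ∉ F) ∧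
      Linkable (prism (cube D)) (F ∪ {p | p.2 = false ∧ p.1 ∈ S} ∪ {p | p.2 = true ∧ p.1 ∈ E}) x := by
  subst hXA hXB
  classical
  set X := F ∪ Finset.univ.image x with hX
  have memF : ∀ {z}, z ∈ F → z ∈ X := fun h => Finset.mem_union_left _ h
  have memx : ∀ p, x p ∈ X := fun p => Finset.mem_union_right _ (Finset.mem_image_of_mem x
    (Finset.mem_univ p))
  have colx : ∀ p, (x p).1 ∈ side X (x p).2 := fun p => mem_side.2 (memx p)
  have colF : ∀ v b, (v, b) ∈ F → v ∈ side X b := fun v b h => mem_side.2 (memF h)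
  have ht' : t ∉ side X false := by rwa [mem_side]
  have hEcard : E.card ≤ 1 := by simpa using Finset.card_le_card hE
  have hFB : (side F true).card ≤ F.card := by
    have := card_side_add F true
    omega
  refine ⟨_, hw, fun v hv hvF => hv.1 (colF v false hvF), ?_⟩
  have hnB : ∀ v ∈ side X false, n v ∉ side X true := by
    intro v hv
    by_cases h : v ∈ side X true
    · exact fun h' => (hn2 v hv h).2 (by simp [h'])
    · rwa [hn1 v hv h]
  have hnE : ∀ v ∈ side X false, n v ∉ E := by
    intro v hv hvE
    have hvt := Finset.mem_singleton.1 (hE hvE)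
    by_cases h : v ∈ side X true
    · exact (hn2 v hv h).2 (by simp [hvt])
    · rw [hn1 v hv h] at hvt
      exact ht' (hvt ▸ hv)
  have colA : ∀ p, (x p).2 = false → (x p).1 ∈ side X false := fun p hp => hp ▸ colx p
  have colB : ∀ p, (x p).2 = true → (x p).1 ∈ side X true := fun p hp => hp ▸ colx p
  let m : κ × Bool → Fin D → Bool := fun p => if (x p).2 = true then (x p).1 else n (x p).1
  have mB : ∀ p, (x p).2 = true → m p = (x p).1 := fun p hp => if_pos hp
  have mA : ∀ p, (x p).2 = false → m p = n (x p).1 := fun p hp => if_neg (by simp [hp])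
  have mcross : ∀ p q, (x p).2 = true → (x q).2 = false → m p ≠ m q := by
    intro p q hp hq h
    rw [mB p hp, mA q hq] at h
    exact hnB _ (colA q hq) (h ▸ colB p hp)
  have hm : Function.Injective m := by
    intro p q h
    cases hp : (x p).2 <;> cases hq : (x q).2
    · rw [mA p hp, mA q hq] at h
      exact hx (Prod.ext (hn (colA p hp) (colA q hq) h) (hp.trans hq.symm))
    · exact absurd h.symm (mcross q p hq hp)
    · exact absurd h (mcross p q hp hq)
    · rw [mB p hp, mB q hq] at h
      exact hx (Prod.ext h (hp.trans hq.symm))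
  refine linkable_prism_of_moves hx (fun p => ?_) hm mB (fun p hp => ?_) ?_
  · rintro ((h | ⟨h, h'⟩) | ⟨h, h'⟩)
    · exact hF p h
    · exact h'.1 (colA p h)
    · exact hEx _ h' p (Prod.ext rfl h)
  · rw [mA p hp]
    by_cases h : (x p).1 ∈ side X true
    · obtain ⟨ha, hb⟩ := hn2 _ (colA p hp) h
      have hb' : (n (x p).1, false) ∉ X := fun h => hb (by simp [mem_side.2 h])
      refine Or.inr ⟨ha, ?_, fun q hq => hb' (hq ▸ memx q)⟩
      rintro ((h | ⟨h, h'⟩) | ⟨h, h'⟩)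
      · exact hb' (memF h)
      · exact h'.2 ⟨_, colA p hp, rfl⟩
      · simp at h
    · exact Or.inl (hn1 _ (colA p hp) h)
  -- `E` adds at most one forbidden vertex, which the spare unit between `D` and `D + 1` absorbs.
  · have hc := Finset.card_union_le (side F true) E
    refine (H κ m (side F true ∪ E) hm (fun p hp => ?_) hκ (by omega)).mono ?_
    · rw [Finset.mem_union, mem_side] at hp
      cases h : (x p).2
      · rw [mA p h] at hp
        rcases hp with hp | hp
        · exact hnB _ (colA p h) (colF _ _ hp)
        · exact hnE _ (colA p h) hp
      · rw [mB p h] at hp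
        rcases hp with hp | hp
        · exact hF p ((Prod.ext rfl h : x p = ((x p).1, true)) ▸ hp)
        · exact hEx _ hp p (Prod.ext rfl h)
    · rintro v ((h | ⟨h, h'⟩) | ⟨h, h'⟩)
      · exact Finset.mem_coe.2 (Finset.mem_union_left _ (mem_side.2 h))
      · simp at h
      · exact Finset.mem_coe.2 (Finset.mem_union_right _ h')

/-- `link_prism_rest` in the case of a single doubly occupied column without escape. -/
theorem link_prism_rest_of_unique {D j : ℕ} (H : StrongLinkage D j) {κ : Type} [Fintype κ]
    {x : κ × Bool → (Fin D → Bool) × Bool} {F : Finset ((Fin D → Bool) × Bool)}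
    {s t : Fin D → Bool} {E : Finset (Fin D → Bool)}
    (hx : Function.Injective x) (hF : ∀ p, x p ∉ F)
    (ht : (t, false) ∉ F ∪ Finset.univ.image x)
    (hE : E ⊆ {t}) (hEx : ∀ v ∈ E, ∀ p, x p ≠ (v, true)) (hκ : Fintype.card κ ≤ j)
    (hcard : 2 * Fintype.card κ + F.card ≤ D)
    {XA XB : Finset (Fin D → Bool)} (hXA : side (F ∪ Finset.univ.image x) false = XA)
    (hXB : side (F ∪ Finset.univ.image x) true = XB) {w : Fin D → Bool} (hw : XA ∩ XB = {w})
    (hnb : nbrs w = (XA ∪ XB ∪ {s, t}).erase w)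
    (hwalk : ∀ u ∈ XA ∪ XB, WalkIn (cube D) {v | v ∉ insert u XA} s t) :
    ∃ S : Set (Fin D → Bool), WalkIn (cube D) S s t ∧ (∀ v ∈ S, (v, false) ∉ F) ∧
      Linkable (prism (cube D)) (F ∪ {p | p.2 = false ∧ p.1 ∈ S} ∪ {p | p.2 = true ∧ p.1 ∈ E}) x := by
  subst hXA hXB
  classical
  set X := F ∪ Finset.univ.image x with hX
  have memF : ∀ {z}, z ∈ F → z ∈ X := fun h => Finset.mem_union_left _ h
  have memx : ∀ p, x p ∈ X := fun p => Finset.mem_union_right _ (Finset.mem_image_of_mem x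
    (Finset.mem_univ p))
  have colF : ∀ v b, (v, b) ∈ F → v ∈ side X b := fun v b h => mem_side.2 (memF h)
  have ht' : t ∉ side X false := by rwa [mem_side]
  have hEcard : E.card ≤ 1 := by simpa using Finset.card_le_card hE
  have hFB : (side F true).card ≤ F.card := by
    have := card_side_add F true
    omega
  have dbl : ∀ v, (v, false) ∈ X → (v, true) ∈ X → v = w := fun v h1 h2 => by
    have : v ∈ side X false ∩ side X true := Finset.mem_inter.2 ⟨mem_side.2 h1, mem_side.2 h2⟩
    simpa [hw] using this
  have hwA : w ∈ side X false := Finset.inter_subset_left (hw ▸ Finset.mem_singleton_self w)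
  -- If the lower end of the bad column is a terminal, its partner lies in column `w` or in an
  -- adjacent one, `u`, because all other occupied columns are neighbours of `w`. That pair is
  -- joined directly through `(u, false)`. Otherwise the lower end is forbidden and need not move.
  -- In both cases the other terminals have free rungs.
  by_cases hp : ∃ p, x p = (w, false)
  · obtain ⟨⟨i, b⟩, hp⟩ := hp
    obtain ⟨⟨u, c⟩, hq⟩ : ∃ z, x (i, !b) = z := ⟨_, rfl⟩
    have huX : (u, c) ∈ X := hq ▸ memx _
    have hu : u ∈ side X false ∪ side X true := by
      rw [Finset.mem_union, mem_side, mem_side]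
      cases c
      exacts [Or.inl huX, Or.inr huX]
    have huF : (u, false) ∉ F := by
      intro h
      cases c with
      | false => exact hF _ (hq ▸ h)
      | true =>
        have := dbl u (memF h) huX
        exact hF (i, b) (by rw [hp, ← this]; exact h)
    have hux : ∀ p, x p = (u, false) → p = (i, b) ∨ p = (i, !b) := by
      intro p h
      cases c with
      | false => exact Or.inr (hx (h.trans hq.symm))
      | true =>
        have := dbl u (h ▸ memx p) huX
        exact Or.inl (hx (by rw [h, hp, this]))
    let P : Set ((Fin D → Bool) × Bool) := {(w, false), (u, false), (u, c)}
    have hjoin : WalkIn (prism (cube D)) P (x (i, b)) (x (i, !b)) := by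
      rw [hp, hq]
      have h1 : WalkIn (prism (cube D)) P (w, false) (u, false) := by
        by_cases huw : u = w
        · rw [huw]; exact .refl (by simp [P])
        · refine .of_adj (prism_adj_same.2 (mem_nbrs.1 ?_)) (by simp [P]) (by simp [P])
          rw [hnb]
          exact Finset.mem_erase.2 ⟨huw, Finset.mem_union_left _ hu⟩
      refine h1.trans ?_
      cases c with
      | false => exact .refl (by simp [P])
      | true => exact .of_adj prism_adj_rung (by simp [P]) (by simp [P])
    refine ⟨_, hwalk u hu, fun v hv hvF => hv (Finset.mem_insert_of_mem (colF v false hvF)), ?_⟩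
    refine Linkable.of_ne i (S₀ := P) ?_ ?_ ?_
    · refine Set.disjoint_left.2 ?_
      rintro z (rfl | rfl | rfl) ((h | ⟨h, h'⟩) | ⟨h, h'⟩)
      · exact hF (i, b) (hp ▸ h)
      · exact h' (Finset.mem_insert_of_mem hwA)
      · simp at h
      · exact huF h
      · exact h' (Finset.mem_insert_self _ _)
      · simp at h
      · exact hF (i, !b) (hq ▸ h)
      · exact h' (Finset.mem_insert_self _ _)
      · simp only at h h'
        subst h
        exact hEx u h' _ hq
    · cases b
      exacts [hjoin, hjoin.symm]
    · have hne : ∀ (p : {k // k ≠ i} × Bool) (b' : Bool), ((p.1.1, p.2) : κ × Bool) ≠ (i, b') :=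
        fun p b' h => p.1.2 (congrArg Prod.fst h)
      have hc1 := Finset.card_union_le (side F true ∪ E) {u}
      have hc2 := Finset.card_union_le (side F true) E
      have hc3 : Fintype.card {k // k ≠ i} + 1 = Fintype.card κ := by
        have := Fintype.card_pos_iff.2 ⟨i⟩
        rw [Fintype.card_subtype_compl, Fintype.card_subtype_eq]
        omega
      rw [Finset.card_singleton] at hc1
      refine linkable_prism_of_rungs H (C := side F true ∪ E ∪ {u}) (fun p q h => ?_)
        (fun p => ?_) (fun p hp' => ⟨?_, fun q hq' => ?_⟩) ?_ (by omega) (by omega)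
      · have := hx h
        simp only [Prod.mk.injEq] at this
        exact Prod.ext (Subtype.ext this.1) this.2
      · rintro (((h | ⟨h, h'⟩) | ⟨h, h'⟩) | (h | h | h))
        · exact hF _ h
        · exact h' (Finset.mem_insert_of_mem (mem_side.2 (h ▸ memx _)))
        · exact hEx _ h' _ (Prod.ext rfl h)
        · exact hne p b (hx (h.trans hp.symm))
        · rcases hux _ h with h | h
          exacts [hne p _ h, hne p _ h]
        · exact hne p _ (hx (h.trans hq.symm))
      · have hpe : ∀ v, (x (p.1, p.2)).1 = v → x (p.1, p.2) = (v, false) :=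
          fun v h => Prod.ext h hp'
        have hw' : (x (p.1, p.2)).1 ≠ w := fun h => hne p b (hx ((hpe _ h).trans hp.symm))
        have hA : ((x (p.1, p.2)).1, false) ∈ X := hpe _ rfl ▸ memx _
        rintro (((h | ⟨h, h'⟩) | ⟨h, h'⟩) | (h | h | h))
        · exact hw' (dbl _ hA (memF h))
        · simp at h
        · exact ht' (mem_side.2 (Finset.mem_singleton.1 (hE h') ▸ hA))
        · simp at h
        · simp at h
        · rcases hux _ (hpe _ (congrArg Prod.fst h)) with h | h
          exacts [hne p _ h, hne p _ h]
      · have hA : x (p.1, p.2) = ((x (p.1, p.2)).1, false) := Prod.ext rfl hp'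
        have := dbl (x (p.1, p.2)).1 (hA ▸ memx _) (hq' ▸ memx _)
        exact hne p b (hx (by rw [hA, hp, this]))
      · rintro v (((h | ⟨h, h'⟩) | ⟨h, h'⟩) | (h | h | h))
        · simp [mem_side.2 h]
        · simp at h
        · exact Finset.mem_union_left _ (Finset.mem_union_right _ h')
        · simp at h
        · simp at h
        · exact Finset.mem_union_right _ (Finset.mem_singleton.2 (congrArg Prod.fst h))
  · push Not at hp
    refine ⟨_, hwalk w (Finset.mem_union_left _ hwA),
      fun v hv hvF => hv (Finset.mem_insert_of_mem (colF v false hvF)), ?_⟩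
    have hc2 := Finset.card_union_le (side F true) E
    refine linkable_prism_of_rungs H (C := side F true ∪ E) hx
      (fun p => ?_) (fun p hp' => ?_) ?_ hκ (by omega)
    · rintro ((h | ⟨h, h'⟩) | ⟨h, h'⟩)
      · exact hF _ h
      · exact h' (Finset.mem_insert_of_mem (mem_side.2 (h ▸ memx _)))
      · exact hEx _ h' _ (Prod.ext rfl h)
    · have hA : x p = ((x p).1, false) := Prod.ext rfl hp'
      have hw' : (x p).1 ≠ w := fun h => hp p (by rw [hA, h])
      refine ⟨?_, fun q hq => hw' (dbl _ (hA ▸ memx p) (hq ▸ memx q))⟩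
      rintro ((h | ⟨h, h'⟩) | ⟨h, h'⟩)
      · exact hw' (dbl _ (hA ▸ memx p) (memF h))
      · simp at h
      · exact ht' (mem_side.2 (Finset.mem_singleton.1 (hE h') ▸ (hA ▸ memx p)))
    · rintro v ((h | ⟨h, h'⟩) | ⟨h, h'⟩)
      · simp [mem_side.2 h]
      · simp at h
      · exact Finset.mem_union_right _ h'

/-- Two vertices `s`, `t` on the side `false` of a prism are joined on that side, and the remaining
pairs are linked, avoiding the vertices of `E ⊆ {t}` on the other side; there is one exception. -/
theorem link_prism_rest {D j : ℕ} (H : StrongLinkage D j) {κ : Type} [Fintype κ]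
    {x : κ × Bool → (Fin D → Bool) × Bool} {F : Finset ((Fin D → Bool) × Bool)}
    {s t : Fin D → Bool} {E : Finset (Fin D → Bool)}
    (hx : Function.Injective x) (hF : ∀ p, x p ∉ F) (hst : s ≠ t)
    (hs : (s, false) ∉ F ∪ Finset.univ.image x) (ht : (t, false) ∉ F ∪ Finset.univ.image x)
    (hE : E ⊆ {t}) (hEx : ∀ v ∈ E, ∀ p, x p ≠ (v, true)) (hκ : Fintype.card κ ≤ j)
    (hcard : 2 * Fintype.card κ + F.card ≤ D) :
    (∃ S : Set (Fin D → Bool), WalkIn (cube D) S s t ∧ (∀ v ∈ S, (v, false) ∉ F) ∧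
      Linkable (prism (cube D)) (F ∪ {p | p.2 = false ∧ p.1 ∈ S} ∪ {p | p.2 = true ∧ p.1 ∈ E}) x) ∨
    side (F ∪ Finset.univ.image x) true = ∅ ∧
      (nbrs s = side (F ∪ Finset.univ.image x) false ∨
        nbrs t = side (F ∪ Finset.univ.image x) false) := by
  set X := F ∪ Finset.univ.image x with hX
  have hXcard : (side X false).card + (side X true).card ≤ D := by
    have h1 := card_side_add X false
    have h2 := Finset.card_union_le F (Finset.univ.image x)
    have h3 := Finset.card_image_le (s := Finset.univ) (f := x)
    simp only [Finset.card_univ, Fintype.card_prod, Fintype.card_bool] at h3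
    rw [← hX] at h2
    simp only [Bool.not_false] at h1
    omega
  have hs' : s ∉ side X false := by rwa [mem_side]
  have ht' : t ∉ side X false := by rwa [mem_side]
  rcases escape_trichotomy hst hs' ht' hXcard with
    ⟨n, hn, hn1, hn2, hw⟩ | ⟨w, hw, hnb, hwalk⟩ | h
  · exact Or.inl (link_prism_rest_of_escape H hx hF ht hE hEx hκ hcard rfl rfl hn hn1 hn2 hw)
  · exact Or.inl (link_prism_rest_of_unique H hx hF ht hE hEx hκ hcard rfl rfl hw hnb hwalk)
  · exact Or.inr h

theorem card_ne {κ : Type} [Fintype κ] [DecidableEq κ] (i : κ) :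
    Fintype.card {k // k ≠ i} + 1 = Fintype.card κ := by
  have := Fintype.card_pos_iff.2 ⟨i⟩
  rw [Fintype.card_subtype_compl, Fintype.card_subtype_eq]
  omega

theorem restrict_pairs_injective {V κ : Type*} {x : κ × Bool → V} (hx : Function.Injective x)
    (i : κ) : Function.Injective fun p : {k // k ≠ i} × Bool => x (p.1, p.2) := fun p q h => by
  have := hx h
  simp only [Prod.mk.injEq] at this
  exact Prod.ext (Subtype.ext this.1) this.2

/-! ### The cases of the inductive step -/

/-- All terminals and forbidden vertices lie on the side `false`, and the terminals other than those
of the pair `i₀`, together with the forbidden vertices, form the neighbourhood of a vertex `z` of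
that pair. -/
theorem linkable_prism_of_nbrs {D j : ℕ} (hD : 3 ≤ D) (H : StrongLinkage D j) {κ : Type} [Fintype κ]
    {x : κ × Bool → (Fin D → Bool) × Bool} {F : Finset ((Fin D → Bool) × Bool)}
    (hx : Function.Injective x) (hF : ∀ p, x p ∉ F) (hκ : Fintype.card κ ≤ j + 1)
    (hκ2 : 2 ≤ Fintype.card κ) (hcard : 2 * Fintype.card κ + F.card ≤ D + 2) (i₀ : κ)
    (hxA : ∀ p, (x p).2 = false) (hFA : ∀ v, (v, true) ∉ F) {z : Fin D → Bool}
    (hz : ∃ b, (x (i₀, b)).1 = z)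
    (hzn : ∀ v, v ∈ nbrs z ↔ (v, false) ∈ F ∨ ∃ i b, i ≠ i₀ ∧ x (i, b) = (v, false)) :
    Linkable (prism (cube D)) F x := by
  classical
  obtain ⟨b₀, rfl⟩ := hz
  -- An end of `i₀` is walled in, so another pair `i`, whose ends are both neighbours of that end,
  -- is joined on the side `false` instead. Everything else, including `i₀`, goes up the rungs to
  -- the empty side.
  obtain ⟨i, hi⟩ : ∃ i, i ≠ i₀ := Fintype.exists_ne_of_one_lt_card (by omega) i₀
  have hxe : ∀ p, x p = ((x p).1, false) := fun p => Prod.ext rfl (hxA p)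
  set X := side F false ∪ Finset.univ.image fun p => (x p).1 with hX
  have hXc : X.card ≤ D + 2 := by
    have h1 := card_side_add F false
    have h2 := Finset.card_union_le (side F false) (Finset.univ.image fun p => (x p).1)
    have h3 := Finset.card_image_le (s := Finset.univ) (f := fun p => (x p).1)
    simp only [Finset.card_univ, Fintype.card_prod, Fintype.card_bool] at h3
    rw [← hX] at h2
    omega
  have memx : ∀ p, (x p).1 ∈ X := fun p =>
    Finset.mem_union_right _ (Finset.mem_image_of_mem _ (Finset.mem_univ p))
  have hinj : ∀ p q, (x p).1 = (x q).1 → p = q := fun p q h =>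
    hx (Prod.ext h ((hxA p).trans (hxA q).symm))
  set R := (X.erase (x (i, false)).1).erase (x (i, true)).1 with hR
  have hne : (x (i, true)).1 ≠ (x (i, false)).1 := fun h => by
    have := hinj _ _ h
    simp at this
  have hRc : R.card ≤ D := by
    rw [hR, Finset.card_erase_of_mem (Finset.mem_erase.2 ⟨hne, memx _⟩),
      Finset.card_erase_of_mem (memx _)]
    omega
  have hmem : ∀ b, (x (i, b)).1 ∈ nbrs (x (i₀, b₀)).1 := fun b =>
    (hzn _).2 (Or.inr ⟨i, b, hi, hxe _⟩)
  have hnot : ∀ b, (x (i, b)).1 ∉ R := by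
    intro b; cases b <;> simp [hR]
  -- Since `D ≥ 3`, the walled-in vertex has a third neighbour `v` besides the pair `i`. If `R` were
  -- the neighbourhood of `x (i, b)`, then `v` would complete a triangle.
  have hsub : ∀ b, ¬ nbrs (x (i, b)).1 ⊆ R := by
    intro b hb
    have h1 := Finset.eq_of_subset_of_card_le hb (by rwa [card_nbrs])
    have h2 : ¬ nbrs (x (i₀, b₀)).1 ⊆ {(x (i, false)).1, (x (i, true)).1} := fun h => by
      have h3 := Finset.card_le_card h
      have h4 := Finset.card_le_two (a := (x (i, false)).1) (b := (x (i, true)).1)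
      rw [card_nbrs] at h3
      omega
    obtain ⟨v, hv, hv'⟩ := Finset.not_subset.1 h2
    simp only [Finset.mem_insert, Finset.mem_singleton, not_or] at hv'
    have hvX : v ∈ X := by
      rcases (hzn v).1 hv with h | ⟨k, c, -, h⟩
      · exact Finset.mem_union_left _ (mem_side.2 h)
      · have := memx (k, c)
        rwa [h] at this
    have hvR : v ∈ nbrs (x (i, b)).1 := by
      rw [h1]
      exact Finset.mem_erase.2 ⟨hv'.2, Finset.mem_erase.2 ⟨hv'.1, hvX⟩⟩
    exact cube_triangle_free (mem_nbrs.1 (hmem b)) (mem_nbrs.1 hv) (mem_nbrs.1 hvR)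
  have hw := cube_walkIn hRc (hnot false) (hnot true) (hsub false) (hsub true)
  refine Linkable.of_ne i (S₀ := {p | p.2 = false ∧ p.1 ∉ R}) ?_ ?_ ?_
  · refine Set.disjoint_left.2 ?_
    rintro ⟨v, c⟩ ⟨rfl, hv⟩ hvF
    have hfe : ∀ b, v ≠ (x (i, b)).1 := fun b h => hF (i, b) (by
      rw [hxe, ← h]; exact hvF)
    exact hv (Finset.mem_erase.2 ⟨hfe _, Finset.mem_erase.2 ⟨hfe _,
      Finset.mem_union_left _ (mem_side.2 hvF)⟩⟩)
  · rw [hxe (i, false), hxe (i, true)]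
    exact hw.prism false fun v hv => ⟨rfl, hv⟩
  · have hc := card_ne i
    refine linkable_prism_of_rungs H (C := ∅) (restrict_pairs_injective hx i) (fun p => ?_)
      (fun p _ => ⟨?_, fun q hq => ?_⟩) ?_ (by omega) (by simp only [Finset.card_empty]; omega)
    · have hfe : ∀ b, (x (p.1, p.2)).1 ≠ (x (i, b)).1 := fun b h =>
        p.1.2 (congrArg Prod.fst (hinj _ _ h))
      rintro (h | ⟨-, h⟩)
      · exact hF _ h
      · exact h (Finset.mem_erase.2 ⟨hfe _, Finset.mem_erase.2 ⟨hfe _, memx _⟩⟩)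
    · rintro (h | ⟨h, -⟩)
      · exact hFA _ h
      · simp at h
    · have := hxA (q.1, q.2)
      rw [hq] at this
      simp at this
    · rintro v (h | ⟨h, -⟩)
      · exact absurd h (hFA v)
      · simp at h

/-- Linkages in a prism with a pair of terminals on a common side. -/
theorem linkable_prism_of_same_side {D j : ℕ} (hD : 3 ≤ D) (H : StrongLinkage D j) {κ : Type}
    [Fintype κ] {x : κ × Bool → (Fin D → Bool) × Bool} {F : Finset ((Fin D → Bool) × Bool)}
    (hx : Function.Injective x) (hF : ∀ p, x p ∉ F) (hκ : Fintype.card κ ≤ j + 1)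
    (hκ2 : 2 ≤ Fintype.card κ) (hcard : 2 * Fintype.card κ + F.card ≤ D + 2) (i₀ : κ)
    (h₀ : ∀ b, (x (i₀, b)).2 = false) : Linkable (prism (cube D)) F x := by
  classical
  have hc := card_ne i₀
  have hxe : ∀ b, x (i₀, b) = ((x (i₀, b)).1, false) := fun b => Prod.ext rfl (h₀ b)
  have hX : ∀ b, ((x (i₀, b)).1, false) ∉
      F ∪ Finset.univ.image fun p : {k // k ≠ i₀} × Bool => x (p.1, p.2) := by
    intro b hb
    rw [← hxe] at hb
    rcases Finset.mem_union.1 hb with h | h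
    · exact hF _ h
    · obtain ⟨p, -, hp⟩ := Finset.mem_image.1 h
      exact p.1.2 (congrArg Prod.fst (hx hp))
  have hst : (x (i₀, false)).1 ≠ (x (i₀, true)).1 := fun h => by
    have := hx (Prod.ext h ((h₀ _).trans (h₀ _).symm))
    simp at this
  rcases link_prism_rest H (E := ∅) (restrict_pairs_injective hx i₀) (fun p => hF _) hst
    (hX false) (hX true) (by simp) (by simp) (by omega) (by omega) with
    ⟨S, hS, hSF, hL⟩ | ⟨hB, hA⟩
  · refine Linkable.of_ne i₀ (S₀ := {p | p.2 = false ∧ p.1 ∈ S}) ?_ ?_ (hL.mono ?_)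
    · refine Set.disjoint_left.2 ?_
      rintro ⟨v, c⟩ ⟨rfl, hv⟩ hvF
      exact hSF v hv hvF
    · rw [hxe false, hxe true]
      exact hS.prism false fun v hv => ⟨rfl, hv⟩
    · exact Set.subset_union_left
  -- In the exceptional case the side `true` is empty and one end of `i₀` has only occupied
  -- neighbours on its side.
  · have hB' : ∀ v, (v, true) ∉
        F ∪ Finset.univ.image fun p : {k // k ≠ i₀} × Bool => x (p.1, p.2) := fun v hv => by
      have := mem_side.2 hv
      simp [hB] at this
    obtain ⟨b, hb⟩ : ∃ b, nbrs (x (i₀, b)).1 = side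
        (F ∪ Finset.univ.image fun p : {k // k ≠ i₀} × Bool => x (p.1, p.2)) false := by
      rcases hA with h | h
      exacts [⟨_, h⟩, ⟨_, h⟩]
    refine linkable_prism_of_nbrs hD H hx hF hκ hκ2 hcard i₀ ?_
      (fun v hv => hB' v (Finset.mem_union_left _ hv)) ⟨b, rfl⟩ (fun v => ?_)
    · rintro ⟨i, c⟩
      by_cases hi : i = i₀
      · exact hi ▸ h₀ c
      · by_contra h
        refine hB' (x (i, c)).1 (Finset.mem_union_right _ (Finset.mem_image.2
          ⟨(⟨i, hi⟩, c), Finset.mem_univ _, Prod.ext rfl ?_⟩))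
        simpa using h
    · rw [hb, mem_side, Finset.mem_union, Finset.mem_image]
      refine or_congr_right ⟨?_, ?_⟩
      · rintro ⟨⟨⟨i, hi⟩, c⟩, -, h⟩
        exact ⟨i, c, hi, h⟩
      · rintro ⟨i, c, hi, h⟩
        exact ⟨(⟨i, hi⟩, c), Finset.mem_univ _, h⟩

/-- Linkages in a prism in which both sides meet every pair of terminals. -/
theorem linkable_prism_of_opposite_sides {D j : ℕ} (H : StrongLinkage D j) {κ : Type}
    [Fintype κ] {x : κ × Bool → (Fin D → Bool) × Bool} {F : Finset ((Fin D → Bool) × Bool)}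
    (hx : Function.Injective x) (hF : ∀ p, x p ∉ F) (hκ : Fintype.card κ ≤ j + 1)
    (hκ2 : 2 ≤ Fintype.card κ) (hcard : 2 * Fintype.card κ + F.card ≤ D + 2) (i₀ : κ)
    (h₀ : (x (i₀, false)).2 = false) (hop : ∀ i, (x (i, false)).2 ≠ (x (i, true)).2)
    (htF : ((x (i₀, true)).1, false) ∉ F) (htx : ∀ p, x p ≠ ((x (i₀, true)).1, false)) :
    Linkable (prism (cube D)) F x := by
  classical
  have hc := card_ne i₀
  have hxf : x (i₀, false) = ((x (i₀, false)).1, false) := Prod.ext rfl h₀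
  have hxt : x (i₀, true) = ((x (i₀, true)).1, true) := Prod.ext rfl (by
    have := hop i₀
    rw [h₀] at this
    simpa using this.symm)
  have hs : ((x (i₀, false)).1, false) ∉
      F ∪ Finset.univ.image fun p : {k // k ≠ i₀} × Bool => x (p.1, p.2) := by
    intro hb
    rw [← hxf] at hb
    rcases Finset.mem_union.1 hb with h | h
    · exact hF _ h
    · obtain ⟨p, -, hp⟩ := Finset.mem_image.1 h
      exact p.1.2 (congrArg Prod.fst (hx hp))
  have ht : ((x (i₀, true)).1, false) ∉
      F ∪ Finset.univ.image fun p : {k // k ≠ i₀} × Bool => x (p.1, p.2) := by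
    intro hb
    rcases Finset.mem_union.1 hb with h | h
    · exact htF h
    · obtain ⟨p, -, hp⟩ := Finset.mem_image.1 h
      exact htx _ hp
  have hst : (x (i₀, false)).1 ≠ (x (i₀, true)).1 := fun h => htx (i₀, false) (h ▸ hxf)
  have hEx : ∀ v ∈ ({(x (i₀, true)).1} : Finset (Fin D → Bool)),
      ∀ p : {k // k ≠ i₀} × Bool, x (p.1, p.2) ≠ (v, true) := by
    intro v hv p hp
    rw [Finset.mem_singleton.1 hv, ← hxt] at hp
    exact p.1.2 (congrArg Prod.fst (hx hp))
  -- The pair is joined to the vertex below its second end and then climbs the rung; `E` keeps that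
  -- end away from the other pairs.
  rcases link_prism_rest H (E := {(x (i₀, true)).1}) (restrict_pairs_injective hx i₀)
    (fun p => hF _) hst hs ht subset_rfl hEx (by omega) (by omega) with
    ⟨S, hS, hSF, hL⟩ | ⟨hB, -⟩
  · refine Linkable.of_ne i₀
      (S₀ := {p | p.2 = false ∧ p.1 ∈ S} ∪ {p | p.2 = true ∧ p.1 = (x (i₀, true)).1}) ?_ ?_
      (hL.mono ?_)
    · refine Set.disjoint_left.2 ?_
      rintro ⟨v, c⟩ (⟨rfl, hv⟩ | ⟨rfl, hv⟩) hvF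
      · exact hSF v hv hvF
      · refine hF (i₀, true) ?_
        simp only at hv
        rw [hxt, ← hv]
        exact hvF
    · rw [hxf, hxt]
      exact (hS.prism false fun v hv => Or.inl ⟨rfl, hv⟩).trans
        (.of_adj prism_adj_rung (Or.inl ⟨rfl, hS.right_mem⟩) (Or.inr ⟨rfl, rfl⟩))
    · simp [Set.union_assoc]
  -- The exception would leave the side `true` empty, but every other pair has an end there.
  · obtain ⟨i, hi⟩ : ∃ i, i ≠ i₀ := Fintype.exists_ne_of_one_lt_card (by omega) i₀
    obtain ⟨b, hb⟩ : ∃ b, (x (i, b)).2 = true := by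
      by_contra! h
      exact hop i (by rw [Bool.eq_false_iff.2 (h false), Bool.eq_false_iff.2 (h true)])
    have : (x (i, b)).1 ∈ side
        (F ∪ Finset.univ.image fun p : {k // k ≠ i₀} × Bool => x (p.1, p.2)) true := by
      refine mem_side.2 (Finset.mem_union_right _ (Finset.mem_image.2
        ⟨(⟨i, hi⟩, b), Finset.mem_univ _, Prod.ext rfl hb⟩))
    simp [hB] at this

/-- Either a coordinate on which some pair agrees puts that pair on one side, or all pairs are
antipodal and every direction separates all of them. In the latter case the direction is chosen so
that the rung at `t` is free. -/
theorem StrongLinkage.succ {D j : ℕ} (hD : 3 ≤ D) (H : StrongLinkage D j) :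
    StrongLinkage (D + 1) (j + 1) := by
  classical
  intro κ _ x F hx hF hκ hcard
  by_cases hκ1 : Fintype.card κ ≤ 1
  · exact strongLinkage_one _ κ x F hx hF hκ1 hcard
  have hκ2 : 2 ≤ Fintype.card κ := by omega
  have transfer : ∀ (e : Fin (D + 1)) (b : Bool),
      Linkable (prism (cube D)) (F.map (cubeSplit e b).toEquiv.toEmbedding) (cubeSplit e b ∘ x) →
      Linkable (cube (D + 1)) F x := fun e b h => .of_iso (cubeSplit e b) (h.mono (by simp))
  have hF' : ∀ (e : Fin (D + 1)) (b : Bool) (v : Fin (D + 1) → Bool),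
      v ∉ F → cubeSplit e b v ∉ F.map (cubeSplit e b).toEquiv.toEmbedding := by
    intro e b v hv hv'
    obtain ⟨u, hu, h⟩ := Finset.mem_map.1 hv'
    exact hv ((cubeSplit e b).injective h ▸ hu)
  by_cases hcase : ∃ i e, x (i, false) e = x (i, true) e
  · obtain ⟨i, e, hie⟩ := hcase
    refine transfer e (x (i, false) e) (linkable_prism_of_same_side hD H
      ((cubeSplit e _).injective.comp hx) (fun p => hF' _ _ _ (hF p)) hκ hκ2 (by simpa using hcard)
      i fun b => ?_)
    cases b <;> simp [cubeSplit_apply, hie]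
  · push Not at hcase
    obtain ⟨i⟩ : Nonempty κ := Fintype.card_pos_iff.1 (by omega)
    set t := x (i, true) with ht
    -- The antipode of `t` is not a neighbour of `t`. If all `D + 1` neighbours were occupied, there
    -- would be `D + 2` occupied vertices besides `t`, one more than the budget allows.
    obtain ⟨e, he⟩ : ∃ e : Fin (D + 1), Function.update t e (!t e) ∉
        F ∪ (Finset.univ.erase (i, true)).image x := by
      by_contra! hall
      have hs : x (i, false) ∉ Finset.univ.image fun e => Function.update t e (!t e) := by
        intro h
        obtain ⟨e, -, he⟩ := Finset.mem_image.1 h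
        obtain ⟨e', he'⟩ : ∃ e', e' ≠ e :=
          Fintype.exists_ne_of_one_lt_card (by rw [Fintype.card_fin]; omega) e
        refine hcase i e' ?_
        rw [← he]
        simp [he', ht]
      have hsub : insert (x (i, false)) (Finset.univ.image fun e => Function.update t e (!t e)) ⊆
          F ∪ (Finset.univ.erase (i, true)).image x := by
        refine Finset.insert_subset (Finset.mem_union_right _ (Finset.mem_image_of_mem x
          (by simp))) fun v hv => ?_
        obtain ⟨e, -, rfl⟩ := Finset.mem_image.1 hv
        exact hall e
      have h1 := Finset.card_le_card hsub
      rw [Finset.card_insert_of_notMem hs,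
        Finset.card_image_of_injective _ (update_not_injective t), Finset.card_univ,
        Fintype.card_fin] at h1
      have h2 := Finset.card_union_le F ((Finset.univ.erase (i, true)).image x)
      have h3 := Finset.card_image_le (s := Finset.univ.erase (i, true)) (f := x)
      rw [Finset.card_erase_of_mem (Finset.mem_univ _), Finset.card_univ, Fintype.card_prod,
        Fintype.card_bool] at h3
      omega
    set b := x (i, false) e with hb
    have hbt : b ≠ t e := hcase i e
    have hcol : ((cubeSplit e b t).1, false) = cubeSplit e b (Function.update t e (!t e)) := by
      have : (!t e) = b := by cases h : t e <;> cases h' : b <;> simp_all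
      rw [cubeSplit_apply, cubeSplit_apply, Fin.removeNth_update, Function.update_self, this]
      simp
    refine transfer e b (linkable_prism_of_opposite_sides H
      ((cubeSplit e _).injective.comp hx) (fun p => hF' _ _ _ (hF p)) hκ hκ2 (by simpa using hcard)
      i ?_ (fun k => ?_) ?_ fun p hp => ?_)
    · simp [cubeSplit_apply, hb]
    · simp only [Function.comp_apply, cubeSplit_apply, ne_eq, Bool.xor_left_inj]
      exact hcase k e
    · simp only [Function.comp_apply, ← ht]
      rw [hcol]
      exact hF' _ _ _ fun h => he (Finset.mem_union_left _ h)
    · simp only [Function.comp_apply, ← ht] at hp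
      rw [hcol] at hp
      have hp' := (cubeSplit e b).injective hp
      refine he (Finset.mem_union_right _ (Finset.mem_image.2 ⟨p, ?_, hp'⟩))
      refine Finset.mem_erase.2 ⟨?_, Finset.mem_univ _⟩
      rintro rfl
      have := congrFun hp' e
      simp [ht] at this

/-- Dimension `d ≥ 3` thus receives `d - 2` pairs, which is at least `⌊(d+1)/2⌋` except when `d =
3`. -/
theorem strongLinkage_add (n : ℕ) : StrongLinkage (3 + n) (1 + n) := by
  induction n with
  | zero => exact strongLinkage_one 3
  | succ n ih =>
    have := ih.succ (Nat.le_add_right 3 n)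
    rwa [Nat.add_assoc, Nat.add_assoc] at this

/-! ### Linkedness of the cube graph and its optimality -/

/-- The graph of the `d`-cube is `⌊(d+1)/2⌋`-linked, unless `d = 3`. -/
theorem cube_isLinked {d : ℕ} (hd : d ≠ 3) : IsLinked (cube d) ((d + 1) / 2) := by
  refine Linkable.isLinked ?_ fun x hx => ?_
  · rw [ENat.card_eq_coe_fintype_card]
    have := Nat.lt_two_pow_self (n := d)
    norm_cast
    simp only [Fintype.card_pi, Fintype.card_bool, Finset.prod_const, Finset.card_univ,
      Fintype.card_fin]
    omega
  · obtain ⟨j, H, hj⟩ : ∃ j, StrongLinkage d j ∧ (d + 1) / 2 ≤ j := by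
      rcases lt_or_ge d 3 with h | h
      · exact ⟨1, strongLinkage_one d, by omega⟩
      · obtain ⟨n, rfl⟩ := Nat.exists_eq_add_of_le h
        exact ⟨1 + n, strongLinkage_add n, by omega⟩
    have := H (Fin ((d + 1) / 2)) x ∅ hx (by simp) (by simpa using hj) (by
      simp only [Fintype.card_fin, Finset.card_empty]; omega)
    simpa using this

/-- The upper bound: for `k > ⌊(d+1)/2⌋` the neighbours of a vertex may all be terminals of other
pairs. -/
theorem cube_not_isLinked {d k : ℕ} (hk : (d + 1) / 2 < k) : ¬ IsLinked (cube d) k := by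
  classical
  rintro ⟨hc, hl⟩
  rw [ENat.card_eq_coe_fintype_card] at hc
  norm_cast at hc
  let o : Fin d → Bool := fun _ => false
  obtain ⟨k, rfl⟩ : ∃ m, k = m + 1 := ⟨k - 1, by omega⟩
  have ho : o ∉ nbrs o := fun h => (mem_nbrs.1 h).ne rfl
  obtain ⟨t, ht⟩ : ∃ t, t ∉ insert o (nbrs o) := by
    by_contra! hall
    have h1 := Finset.card_le_card (fun w _ => hall w :
      (Finset.univ : Finset (Fin d → Bool)) ⊆ insert o (nbrs o))
    rw [Finset.card_insert_of_notMem ho, card_nbrs, Finset.card_univ] at h1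
    omega
  rw [Finset.mem_insert, not_or] at ht
  have hcu : (Finset.univ \ ({o, t} : Finset (Fin d → Bool))).card + 2 =
      Fintype.card (Fin d → Bool) := by
    rw [Finset.card_sdiff_of_subset (Finset.subset_univ _), Finset.card_pair (Ne.symm ht.1),
      Finset.card_univ]
    omega
  -- With one pair reserved for `o` and `t`, the bound on `k` gives `2 * k ≥ d`, so all neighbours
  -- of `o` fit among the other terminals.
  obtain ⟨Y, hY1, hY2, hYc⟩ := Finset.exists_subsuperset_card_eq (s := nbrs o) (n := 2 * k)
    (t := Finset.univ \ {o, t}) (fun v hv => by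
      simp only [Finset.mem_sdiff, Finset.mem_univ, Finset.mem_insert, Finset.mem_singleton,
        true_and, not_or]
      exact ⟨fun h => ho (h ▸ hv), fun h => ht.2 (h ▸ hv)⟩)
    (by rw [card_nbrs]; omega) (by omega)
  have e : Fin k ⊕ Fin k ≃ Y := (finSumFinEquiv.trans (finCongr (by omega))).trans
    (Finset.equivFin Y).symm
  have hYn : ∀ z, (e z : Fin d → Bool) ≠ o ∧ (e z : Fin d → Bool) ≠ t := by
    intro z
    have := hY2 (e z).2
    simpa using this
  obtain ⟨L, hL⟩ := hl (Fin.cons o fun i => e (.inl i)) (Fin.cons t fun i => e (.inr i)) (by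
    rintro (i | i) (l | l) h <;> induction i using Fin.cases <;> induction l using Fin.cases <;>
      simp only [Sum.elim_inl, Sum.elim_inr, Fin.cons_zero, Fin.cons_succ] at h
    all_goals first
      | rfl
      | exact absurd h (hYn _).1
      | exact absurd h (hYn _).2
      | exact absurd h.symm (hYn _).1
      | exact absurd h.symm (hYn _).2
      | exact absurd h ht.1
      | exact absurd h.symm ht.1
      | simpa using e.injective (Subtype.ext h))
  have hpath : ∀ p : (cube d).Walk o t, ∃ v ∈ p.support, v ∈ nbrs o := by
    intro p
    cases p with
    | nil => exact absurd rfl ht.1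
    | cons h q => exact ⟨_, by simp, mem_nbrs.2 h⟩
  obtain ⟨v, hv, hvn⟩ := hpath (L 0).1
  obtain ⟨z, hz⟩ := e.surjective ⟨v, hY1 hvn⟩
  have hz' : (e z : Fin d → Bool) = v := congrArg Subtype.val hz
  rcases z with i | i
  · refine hL 0 i.succ (Fin.succ_ne_zero i).symm v hv ?_
    have := (L i.succ).1.start_mem_support
    simpa [hz'] using this
  · refine hL 0 i.succ (Fin.succ_ne_zero i).symm v hv ?_
    have := (L i.succ).1.end_mem_support
    simpa [hz'] using this

/-! ### Faces, vertices and graphs of polytopes -/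

namespace IsPolytope

variable {n : ℕ} {P F : Set (Fin n → ℝ)} {x : Fin n → ℝ}

theorem isCompact (hP : IsPolytope P) : IsCompact P := by
  obtain ⟨S, hS, rfl⟩ := hP
  exact hS.isCompact_convexHull (𝕜 := ℝ)

theorem convex (hP : IsPolytope P) : Convex ℝ P := by
  obtain ⟨S, -, rfl⟩ := hP
  exact convex_convexHull ℝ S

theorem finite_extremePoints (hP : IsPolytope P) : (P.extremePoints ℝ).Finite := by
  obtain ⟨S, hS, rfl⟩ := hP
  exact hS.subset extremePoints_convexHull_subset

/-- Extreme points of a polytope are exposed. -/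
theorem isFace_singleton_iff (hP : IsPolytope P) : IsFace P {x} ↔ x ∈ P.extremePoints ℝ := by
  rw [IsFace, ← mem_exposedPoints_iff_exposed_singleton]
  refine ⟨fun h => exposedPoints_subset_extremePoints h, fun hx => ?_⟩
  obtain ⟨S, hS, rfl⟩ := hP
  have hxS : x ∈ S := extremePoints_convexHull_subset hx
  have hx' : x ∉ convexHull ℝ (S \ {x}) := fun h =>
    ((convex_convexHull ℝ S).mem_extremePoints_iff_mem_sdiff_convexHull_sdiff.1 hx).2
      (convexHull_mono (Set.sdiff_subset_sdiff_left (subset_convexHull ℝ S)) h)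
  have hfin : (S \ {x}).Finite := hS.subset Set.sdiff_subset
  -- A functional separating `x` from the hull of the other generators has its maximum on the whole
  -- hull at `x` alone.
  obtain ⟨l, u, h1, h2⟩ := geometric_hahn_banach_closed_point (convex_convexHull ℝ (S \ {x}))
    (hfin.isClosed_convexHull (𝕜 := ℝ)) hx'
  refine ⟨hx.1, l, fun y hy => ?_⟩
  rcases (S \ {x}).eq_empty_or_nonempty with he | hne
  · have hSx : S = {x} := Set.Subset.antisymm (Set.sdiff_eq_empty.1 he) (by simpa using hxS)
    rw [hSx, convexHull_singleton] at hy
    obtain rfl := Set.mem_singleton_iff.1 hy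
    exact ⟨le_rfl, fun _ => rfl⟩
  · have hSi : S = insert x (S \ {x}) := by
      rw [Set.insert_sdiff_singleton, Set.insert_eq_of_mem hxS]
    rw [hSi, convexHull_insert hne, mem_convexJoin] at hy
    obtain ⟨x', hx', z, hz, a, b, ha, hb, hab, rfl⟩ := hy
    obtain rfl := Set.mem_singleton_iff.1 hx'
    have hlz : l z < l x' := (h1 z hz).trans h2
    have hl : l (a • x' + b • z) = l x' - b * (l x' - l z) := by
      obtain rfl : a = 1 - b := by linarith
      simp only [map_add, map_smul, smul_eq_mul]
      ring
    have hb' : 0 ≤ b * (l x' - l z) := mul_nonneg hb (by linarith)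
    refine ⟨by rw [hl]; linarith, fun h => ?_⟩
    have hb0 : b = 0 := by
      by_contra hb0
      have : 0 < b * (l x' - l z) :=
        mul_pos (lt_of_le_of_ne hb (Ne.symm hb0)) (by linarith)
      rw [hl] at h
      linarith
    obtain rfl : a = 1 := by linarith
    simp [hb0]

/-- A face of a polytope is the convex hull of the vertices of the polytope that it contains. -/
theorem face_eq_convexHull (hP : IsPolytope P) (hF : IsFace P F) :
    F = convexHull ℝ {x | x ∈ F ∧ IsFace P {x}} := by
  have hconv : Convex ℝ F := hF.convex hP.convex
  have hsub : F.extremePoints ℝ ⊆ {x | x ∈ F ∧ IsFace P {x}} := fun x hx =>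
    ⟨hx.1, hP.isFace_singleton_iff.2 (hF.isExtreme.extremePoints_subset_extremePoints hx)⟩
  refine Set.Subset.antisymm ?_ (convexHull_min (fun x hx => hx.1) hconv)
  have hfin : (F.extremePoints ℝ).Finite :=
    hP.finite_extremePoints.subset hF.isExtreme.extremePoints_subset_extremePoints
  conv_lhs => rw [← closure_convexHull_extremePoints (hF.isCompact hP.isCompact) hconv,
    (hfin.isClosed_convexHull (𝕜 := ℝ)).closure_eq]
  exact convexHull_mono hsub

theorem exists_vertex_mem (hP : IsPolytope P) (hF : IsFace P F) (hne : F.Nonempty) :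
    ∃ x ∈ F, IsFace P {x} := by
  rw [hP.face_eq_convexHull hF, convexHull_nonempty_iff] at hne
  exact hne

end IsPolytope

instance {n : ℕ} {P : Set (Fin n → ℝ)} : OrderBot (FaceLattice P) where
  bot := ⟨∅, isExposed_empty⟩
  bot_le F := Set.empty_subset F.1

/-- A vertex, as an element of the face lattice. -/
def Vertex.toFace {n : ℕ} {P : Set (Fin n → ℝ)} (v : Vertex P) : FaceLattice P := ⟨{v.1}, v.2⟩

theorem Vertex.toFace_injective {n : ℕ} {P : Set (Fin n → ℝ)} :
    Function.Injective (Vertex.toFace (P := P)) := fun _ _ h =>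
  Subtype.ext (Set.singleton_injective (congrArg Subtype.val h))

theorem Vertex.toFace_le_iff {n : ℕ} {P : Set (Fin n → ℝ)} {v : Vertex P} {F : FaceLattice P} :
    v.toFace ≤ F ↔ v.1 ∈ F.1 := Set.singleton_subset_iff

/-- Every nonempty face contains a vertex, so minimal nonempty faces are vertices. Hence lattice
isomorphisms carry vertices to vertices. -/
theorem IsPolytope.isAtom_iff {n : ℕ} {P : Set (Fin n → ℝ)} (hP : IsPolytope P)
    {F : FaceLattice P} : IsAtom F ↔ ∃ v : Vertex P, v.toFace = F := by
  have hne : ∀ v : Vertex P, v.toFace ≠ ⊥ := fun v h =>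
    Set.singleton_ne_empty v.1 (congrArg Subtype.val h)
  constructor
  · intro h
    obtain ⟨x, hxF, hx⟩ := hP.exists_vertex_mem F.2 (Set.nonempty_iff_ne_empty.2 fun h0 =>
      h.1 (Subtype.ext h0))
    refine ⟨⟨x, hx⟩, ?_⟩
    exact (h.le_iff.1 (Vertex.toFace_le_iff.2 hxF)).resolve_left (hne _)
  · rintro ⟨v, rfl⟩
    refine ⟨hne v, fun G hG => ?_⟩
    rcases Set.subset_singleton_iff_eq.1 (show G.1 ⊆ {v.1} from hG.le) with h | h
    · exact Subtype.ext h
    · exact absurd (Subtype.ext h) hG.ne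

/-- Adjacency in the graph of a polytope in terms of the face lattice. -/
theorem IsPolytope.adj_iff {n : ℕ} {P : Set (Fin n → ℝ)} (hP : IsPolytope P) {u v : Vertex P} :
    (polytopeGraph P).Adj u v ↔
      u ≠ v ∧ ∃ F : FaceLattice P, ∀ w : Vertex P, w.toFace ≤ F ↔ w = u ∨ w = v := by
  refine and_congr_right fun huv => ⟨?_, ?_⟩
  · rintro ⟨e, he, hd, hu, hv⟩
    refine ⟨⟨e, he⟩, fun w => ?_⟩
    rw [Vertex.toFace_le_iff]
    refine ⟨fun hw => ?_, ?_⟩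
    -- One of three collinear vertices lies between the other two and, being extreme, coincides with
    -- one of them.
    · have hcol : Collinear ℝ e := collinear_iff_finrank_le_one.2 hd.2.le
      have hcol' : Collinear ℝ {u.1, v.1, w.1} := hcol.subset (by
        rintro x (rfl | rfl | rfl)
        exacts [hu, hv, hw])
      have ext : ∀ z : Vertex P, ∀ a ∈ P, ∀ b ∈ P, z.1 ∈ segment ℝ a b → a = z.1 ∨ b = z.1 :=
        fun z => (mem_extremePoints_iff_forall_segment.1 (hP.isFace_singleton_iff.1 z.2)).2
      have hmem : ∀ z : Vertex P, z.1 ∈ P := fun z => (hP.isFace_singleton_iff.1 z.2).1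
      rcases hcol'.wbtw_or_wbtw_or_wbtw with h | h | h
      · rcases ext v _ (hmem u) _ (hmem w) h.mem_segment with h | h
        · exact absurd (Subtype.ext h) huv
        · exact Or.inr (Subtype.ext h)
      · rcases ext w _ (hmem v) _ (hmem u) h.mem_segment with h | h
        · exact Or.inr (Subtype.ext h.symm)
        · exact Or.inl (Subtype.ext h.symm)
      · rcases ext u _ (hmem w) _ (hmem v) h.mem_segment with h | h
        · exact Or.inl (Subtype.ext h)
        · exact absurd (Subtype.ext h.symm) huv
    · rintro (rfl | rfl)
      exacts [hu, hv]
  · rintro ⟨F, hF⟩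
    have hu : u.1 ∈ F.1 := Vertex.toFace_le_iff.1 ((hF u).2 (Or.inl rfl))
    have hv : v.1 ∈ F.1 := Vertex.toFace_le_iff.1 ((hF v).2 (Or.inr rfl))
    refine ⟨F.1, F.2, ⟨⟨_, hu⟩, ?_⟩, hu, hv⟩
    have hset : {x | x ∈ F.1 ∧ IsFace P {x}} = {u.1, v.1} := by
      ext x
      constructor
      · rintro ⟨hx, hx'⟩
        rcases (hF ⟨x, hx'⟩).1 (Vertex.toFace_le_iff.2 hx) with h | h
        · exact Or.inl (congrArg Subtype.val h)
        · exact Or.inr (congrArg Subtype.val h)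
      · rintro (rfl | rfl)
        exacts [⟨hu, u.2⟩, ⟨hv, v.2⟩]
    -- The face is the hull of its two vertices, so its direction is spanned by their nonzero
    -- difference.
    rw [hP.face_eq_convexHull F.2, hset, ← direction_affineSpan, affineSpan_convexHull,
      direction_affineSpan, vectorSpan_pair, finrank_span_singleton]
    exact vsub_ne_zero.2 fun h => huv (Subtype.ext h)

/-- Combinatorially equivalent polytopes have isomorphic graphs. -/
theorem CombEquiv.nonempty_graphIso {m n : ℕ} {P : Set (Fin m → ℝ)} {Q : Set (Fin n → ℝ)}
    (hP : IsPolytope P) (hQ : IsPolytope Q) (h : CombEquiv P Q) :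
    Nonempty (polytopeGraph P ≃g polytopeGraph Q) := by
  obtain ⟨φ⟩ := h
  have hf : ∀ v : Vertex P, ∃ w : Vertex Q, w.toFace = φ v.toFace := fun v =>
    hQ.isAtom_iff.1 ((φ.isAtom_iff _).2 (hP.isAtom_iff.2 ⟨v, rfl⟩))
  have hg : ∀ w : Vertex Q, ∃ v : Vertex P, v.toFace = φ.symm w.toFace := fun w =>
    hP.isAtom_iff.1 ((φ.symm.isAtom_iff _).2 (hQ.isAtom_iff.2 ⟨w, rfl⟩))
  choose f hf using hf
  choose g hg using hg
  let e : Vertex P ≃ Vertex Q := ⟨f, g, fun v => Vertex.toFace_injective (by rw [hg, hf]; simp),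
    fun w => Vertex.toFace_injective (by rw [hf, hg]; simp)⟩
  have he : ∀ v, (e v).toFace = φ v.toFace := hf
  refine ⟨⟨e, fun {u v} => ?_⟩⟩
  rw [hP.adj_iff, hQ.adj_iff, ne_eq, e.injective.eq_iff, φ.surjective.exists]
  refine and_congr_right fun _ => exists_congr fun F => ?_
  rw [e.surjective.forall]
  refine forall_congr' fun w => ?_
  rw [he, φ.le_iff_le, e.injective.eq_iff, e.injective.eq_iff]

/-! ### The graph of the standard cube -/

theorem isPolytope_stdCube (d : ℕ) : IsPolytope (stdCube d) := by
  refine ⟨_, ?_, rfl⟩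
  refine (Set.Finite.pi' (t := fun _ : Fin d => ({1, -1} : Set ℝ)) fun _ => by simp).subset ?_
  intro x hx i
  simpa using hx i

/-- The sign vector of a vertex of the cube graph. -/
def signVec {d : ℕ} (u : Fin d → Bool) : Fin d → ℝ := fun i => if u i then 1 else -1

theorem signVec_apply_eq_iff {d : ℕ} {u v : Fin d → Bool} {i : Fin d} :
    signVec u i = signVec v i ↔ u i = v i := by
  cases hu : u i <;> cases hv : v i <;> norm_num [signVec, hu, hv]

theorem signVec_injective {d : ℕ} : Function.Injective (signVec (d := d)) := fun _ _ h =>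
  funext fun i => signVec_apply_eq_iff.1 (congrFun h i)

theorem signVec_mem_stdCube {d : ℕ} (u : Fin d → Bool) : signVec u ∈ stdCube d :=
  subset_convexHull ℝ _ fun i => by cases h : u i <;> simp [signVec, h]

theorem signVec_mul_le {d : ℕ} (u : Fin d → Bool) {x : Fin d → ℝ} (hx : x ∈ stdCube d)
    (i : Fin d) : signVec u i * x i ≤ 1 := by
  have hconv : Convex ℝ {x : Fin d → ℝ | signVec u i * x i ≤ 1} :=
    convex_halfSpace_le (signVec u i • (LinearMap.proj i : (Fin d → ℝ) →ₗ[ℝ] ℝ)).isLinear 1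
  refine convexHull_min (fun y hy => ?_) hconv hx
  rcases hy i with h | h <;> cases hu : u i <;> norm_num [signVec, hu, h]

theorem signVec_mul_eq_one_iff {d : ℕ} {u : Fin d → Bool} {i : Fin d} {a : ℝ} :
    signVec u i * a = 1 ↔ a = signVec u i := by
  cases hu : u i
  · simp only [signVec, hu]
    constructor <;> intro h <;> simp at h ⊢ <;> linarith
  · simp [signVec, hu]

/-- Fixing some coordinates of a vertex gives a face of the standard cube. -/
theorem isFace_stdCube {d : ℕ} (u : Fin d → Bool) (I : Finset (Fin d)) :
    IsFace (stdCube d) {x | x ∈ stdCube d ∧ ∀ i ∈ I, x i = signVec u i} := by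
  intro _
  let l : (Fin d → ℝ) →L[ℝ] ℝ := ∑ i ∈ I, signVec u i • ContinuousLinearMap.proj i
  have hl : ∀ x, l x = ∑ i ∈ I, signVec u i * x i := fun x => by simp [l]
  have hle : ∀ y ∈ stdCube d, l y ≤ I.card := fun y hy => by
    rw [hl]
    calc _ ≤ ∑ i ∈ I, (1 : ℝ) := Finset.sum_le_sum fun i _ => signVec_mul_le u hy i
      _ = I.card := by simp
  have hiff : ∀ y ∈ stdCube d, l y = I.card ↔ ∀ i ∈ I, y i = signVec u i := fun y hy => by
    rw [hl]
    have : (I.card : ℝ) = ∑ i ∈ I, (1 : ℝ) := by simp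
    rw [this, Finset.sum_eq_sum_iff_of_le fun i _ => signVec_mul_le u hy i]
    exact forall₂_congr fun i _ => signVec_mul_eq_one_iff
  refine ⟨l, ?_⟩
  ext x
  refine and_congr_right fun hx => ?_
  rw [← hiff x hx]
  have hu := (hiff _ (signVec_mem_stdCube u)).2 fun _ _ => rfl
  exact ⟨fun h y hy => h ▸ hle y hy, fun h => le_antisymm (hle x hx)
    (hu ▸ h _ (signVec_mem_stdCube u))⟩

theorem isFace_singleton_signVec {d : ℕ} (u : Fin d → Bool) :
    IsFace (stdCube d) {signVec u} := by
  convert isFace_stdCube u Finset.univ using 1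
  ext x
  refine ⟨?_, fun h => funext fun i => h.2 i (Finset.mem_univ i)⟩
  rintro rfl
  exact ⟨signVec_mem_stdCube u, fun _ _ => rfl⟩

/-- The vertices of the standard cube are the sign vectors. -/
noncomputable def stdCubeVertexEquiv (d : ℕ) : (Fin d → Bool) ≃ Vertex (stdCube d) :=
  Equiv.ofBijective (fun u => ⟨signVec u, isFace_singleton_signVec u⟩)
    ⟨fun _ _ h => signVec_injective (congrArg Subtype.val h), fun v => by
      classical
      have hv : ∀ i, v.1 i = 1 ∨ v.1 i = -1 := extremePoints_convexHull_subset
        ((isPolytope_stdCube d).isFace_singleton_iff.1 v.2)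
      refine ⟨fun i => decide (v.1 i = 1), Subtype.ext (funext fun i => ?_)⟩
      rcases hv i with h | h <;> norm_num [signVec, h]⟩

theorem stdCubeVertexEquiv_coe {d : ℕ} (u : Fin d → Bool) :
    (stdCubeVertexEquiv d u).1 = signVec u := rfl

/-- The graph of the standard cube is the cube graph. -/
noncomputable def stdCubeGraphIso (d : ℕ) : cube d ≃g polytopeGraph (stdCube d) where
  toEquiv := stdCubeVertexEquiv d
  map_rel_iff' {u v} := by
    rw [(isPolytope_stdCube d).adj_iff, ne_eq, (stdCubeVertexEquiv d).injective.eq_iff]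
    simp only [(stdCubeVertexEquiv d).surjective.forall, Vertex.toFace_le_iff,
      stdCubeVertexEquiv_coe, (stdCubeVertexEquiv d).injective.eq_iff]
    constructor
    · rintro ⟨huv, F, hF⟩
      obtain ⟨i, hi⟩ := Function.ne_iff.1 huv
      have hu := (hF u).2 (Or.inl rfl)
      have hv := (hF v).2 (Or.inr rfl)
      obtain ⟨l, hl⟩ := F.2 ⟨_, hu⟩
      rw [hl] at hu hv
      -- Exchanging the `i`-th coordinates of `u` and `v` preserves the sum of their sign vectors.
      -- As `l` is maximal at both, it is maximal at `w` too, so `w` lies on the face and must be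
      -- `v`.
      set w := Function.update u i (!u i) with hw
      set w' := Function.update v i (!v i) with hw'
      have hsum : signVec w + signVec w' = signVec u + signVec v := by
        funext k
        by_cases hk : k = i
        · subst hk
          cases h1 : u k <;> cases h2 : v k <;> simp_all [signVec]
        · simp [signVec, hw, hw', hk]
      have hsum' := congrArg l hsum
      rw [map_add, map_add] at hsum'
      have h1 := hv.2 _ (signVec_mem_stdCube w')
      have hwF : signVec w ∈ F.1 := by
        rw [hl]
        refine ⟨signVec_mem_stdCube w, fun y hy => (hu.2 y hy).trans ?_⟩
        linarith
      rcases (hF w).1 hwF with h | h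
      · have := congrFun h i
        simp [hw] at this
      · exact h ▸ cube_adj_update u i
    · intro h
      obtain ⟨i, rfl⟩ := cube_adj_iff.1 h
      refine ⟨h.ne, ⟨_, isFace_stdCube u (Finset.univ.erase i)⟩, fun w => ?_⟩
      have key : signVec w ∈ {x | x ∈ stdCube d ∧
          ∀ k ∈ Finset.univ.erase i, x k = signVec u k} ↔ ∀ k, k ≠ i → w k = u k := by
        refine ⟨fun h k hk => signVec_apply_eq_iff.1 (h.2 k (by simp [hk])), fun h =>
          ⟨signVec_mem_stdCube w, fun k hk => signVec_apply_eq_iff.2 (h k (by simpa using hk))⟩⟩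
      rw [key]
      constructor
      · intro hk
        by_cases hi : w i = u i
        · left
          funext k
          by_cases hki : k = i
          · rw [hki, hi]
          · exact hk k hki
        · right
          funext k
          by_cases hki : k = i
          · subst hki
            simpa using Bool.eq_not_of_ne hi
          · rw [Function.update_of_ne hki, hk k hki]
      · rintro (rfl | rfl) k hk
        · rfl
        · exact Function.update_of_ne hk _ _

theorem hasDim_stdCube (d : ℕ) : HasDim (stdCube d) d := by
  refine ⟨⟨_, signVec_mem_stdCube fun _ => true⟩, ?_⟩
  have htop : vectorSpan ℝ (stdCube d) = ⊤ := by
    rw [eq_top_iff, ← (Pi.basisFun ℝ (Fin d)).span_eq, Submodule.span_le]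
    rintro _ ⟨i, rfl⟩
    -- Half the difference of two vertices along an edge in direction `i` is the `i`-th basis
    -- vector.
    have h := vsub_mem_vectorSpan ℝ (signVec_mem_stdCube fun _ => true)
      (signVec_mem_stdCube (Function.update (fun _ : Fin d => true) i false))
    have h2 := Submodule.smul_mem _ (1 / 2 : ℝ) h
    refine (congrArg (· ∈ vectorSpan ℝ (stdCube d)) (funext fun k => ?_)).mpr h2
    by_cases hk : k = i
    · subst hk; norm_num [signVec]
    · simp [signVec, hk]
  rw [htop, finrank_top, Module.finrank_fin_fun]

/-! ### Transfer to arbitrary cubes -/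

theorem IsCube.nonempty_graphIso {n d : ℕ} {P : Set (Fin n → ℝ)} (hP : IsCube d P) :
    Nonempty (cube d ≃g polytopeGraph P) := by
  obtain ⟨φ⟩ := hP.2.nonempty_graphIso hP.1 (isPolytope_stdCube d)
  exact ⟨(stdCubeGraphIso d).trans φ.symm⟩

/-- Every `d`-cube with `d ≠ 3` is `⌊(d+1)/2⌋`-linked. This is best possible: no `d`-cube is
`k`-linked for a larger `k`, and so, for a larger `k`, not all `d`-polytopes are `k`-linked. -/
theorem mainTheorem1 (d : ℕ) :
    (d ≠ 3 → ∀ (n : ℕ) (P : Set (Fin n → ℝ)), IsCube d P →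
      IsLinked (polytopeGraph P) ((d + 1) / 2)) ∧
    (∀ k : ℕ, (d + 1) / 2 < k →
      (∀ (n : ℕ) (P : Set (Fin n → ℝ)), IsCube d P → ¬ IsLinked (polytopeGraph P) k) ∧
      ∃ P : Set (Fin d → ℝ), IsPolytope P ∧ HasDim P d ∧ ¬ IsLinked (polytopeGraph P) k) := by
  refine ⟨fun hd n P hP => ?_, fun k hk => ⟨fun n P hP h => ?_, stdCube d, isPolytope_stdCube d,
    hasDim_stdCube d, fun h => ?_⟩⟩
  · obtain ⟨φ⟩ := hP.nonempty_graphIso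
    exact (cube_isLinked hd).of_iso φ
  · obtain ⟨φ⟩ := hP.nonempty_graphIso
    exact cube_not_isLinked hk (h.of_iso φ.symm)
  · exact cube_not_isLinked hk (h.of_iso (stdCubeGraphIso d).symm)
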